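/- **Theorem 2.2.** Write $e(z)=e^{2\pi i z}$, let $\mathcal H_1$ be the upper half plane and let $\mathcal H_2$ be the Siegel upper half space of symmetric $2\times2$ complex matrices with positive definite imaginary part. For $k\in\mathbb Z$, a function $f:\mathcal H_2\to\mathbb C$ and a real symplectic matrix $\sigma=\begin{pmatrix}A&B\\C&D\end{pmatrix}$ with $2\times 2$ blocks, put $(f|_k\sigma)(\Omega)=\det(C\Omega+D)^{-k}f\big((A\Omega+B)(C\Omega+D)^{-1}\big)$. For $N\in\mathbb N$, $N\ge1$, let $$K(N)=\begin{pmatrix}*&N*&*&*\\ *&*&*&*/N\\ *&N*&*&*\\ N*&N*&N*&*\end{pmatrix}\cap \mathrm{Sp}_2(\mathbb Q),\qquad \Gamma^J=\begin{pmatrix}*&0&*&*\\ *&*&*&*\\ *&0&*&*\\ 0&0&0&*\end{pmatrix}\cap \mathrm{Sp}_2(\mathbb Z)\qquad(*\in\mathbb Z),$$ and $\mu_N=\begin{pmatrix}-F_N'&0\\0&F_N\end{pmatrix}$, where $F_N=\frac1{\sqrt N}\begin{pmatrix}0&1\\-N&0\end{pmatrix}$ and $F_N'$ is its transpose. For $\epsilon\in\{1,-1\}$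 let $M_k(K(N))^{\epsilon}$ be the space of holomorphic $f:\mathcal H_2\to\mathbb C$ with $f|_k\sigma=f$ for all $\sigma\in K(N)$ and $f|_k\mu_N=\epsilon f$. For $k,m\in\mathbb Z_{\ge0}$ let $J_{k,m}$ be the space of Jacobi forms of weight $k$ and index $m$: holomorphic $\phi:\mathcal H_1\times\mathbb C\to\mathbb C$ such that the function $\begin{pmatrix}\tau&z\\z&\omega\end{pmatrix}\mapsto\phi(\tau,z)e(m\omega)$ on $\mathcal H_2$ is invariant under $|_k\sigma$ for all $\sigma\in\Gamma^J$, and such that $\phi$ has a Fourier series of the form $\phi(\tau,z)=\sum_{n,r\in\mathbb Z:\ n\ge0,\ 4mn\ge r^2}c(n,r;\phi)\,e(n\tau+rz)$. Let $k\in\mathbb Z_{\ge0}$, $N\ge1$, $\epsilon\in\{1,-1\}$, and let $\Phi=\sum_{m\ge0,\ N\mid m}\phi_m\xi^m$ be a formal power series with $\phi_m\in J_{k,m}$ for every $m$. Then the following are equivalent. 1. $\Phi$ is the Fourier–Jacobi expansion of some $f\in M_k(K(N))^{\epsilon}$; that is, $f\begin{pmatrix}\tau&z\\z&\omega\end{pmatrix}=\sum_{m\ge0,\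 N\mid m}\phi_m(\tau,z)\,e(m\omega)$ (absolutely convergent) on $\mathcal H_2$. 2. Let $\mathcal X$ be the set of all positive semidefinite matrices $\begin{pmatrix}n&r/2\\r/2&m\end{pmatrix}$ with $n,r,m\in\mathbb Z$ and $N\mid m$. Both of the following hold: * (Involution($\epsilon$)) $c(n,r;\phi_m)=\epsilon\,c\big(\tfrac mN,-r;\phi_{nN}\big)$ for all $\begin{pmatrix}n&r/2\\r/2&m\end{pmatrix}\in\mathcal X$; * (growth) for every $\rho>1$ there is $A>0$ such that $|c(n,r;\phi_m)|\le A\rho^{\,n+m}$ for all $\begin{pmatrix}n&r/2\\r/2&m\end{pmatrix}\in\mathcal X$. -/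

import Mathlib

open Matrix

noncomputable section

namespace Paramodular

/-- The index type of the rows and columns of 4 by 4 matrices, written in 2 by 2 blocks. -/
abbrev Idx : Type := Fin 2 ⊕ Fin 2

/-- `e(z) = exp(2πiz)`. -/
def e (z : ℂ) : ℂ := Complex.exp (2 * Real.pi * Complex.I * z)

/-- The Siegel upper half space of degree two: symmetric complex matrices with
positive definite imaginary part. -/
def siegelH2 : Set (Matrix (Fin 2) (Fin 2) ℂ) :=
  {Ω | Ω.IsSymm ∧ (Ω.map Complex.im).PosDef}

/-- The weight `k` slash action
`(f|_k σ)(Ω) = det(CΩ + D)^(-k) f((AΩ + B)(CΩ + D)⁻¹)`. Functions on the half space are modelled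
by total functions, of which only the values on `siegelH2` are ever used. -/
def slash (k : ℤ) (f : Matrix (Fin 2) (Fin 2) ℂ → ℂ) (σ : Matrix Idx Idx ℝ)
    (Ω : Matrix (Fin 2) (Fin 2) ℂ) : ℂ :=
  let A := σ.toBlocks₁₁.map Complex.ofReal
  let B := σ.toBlocks₁₂.map Complex.ofReal
  let C := σ.toBlocks₂₁.map Complex.ofReal
  let D := σ.toBlocks₂₂.map Complex.ofReal
  (C * Ω + D).det ^ (-k) * f ((A * Ω + B) * (C * Ω + D)⁻¹)

/-- The paramodular group `K(N)`: the elements of `Sp₂(ℚ)` of the shape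
`(*, N*, *, *; *, *, *, */N; *, N*, *, *; N*, N*, N*, *)` with all `*` integers. -/
def paramodularGroup (N : ℕ) : Set (Matrix Idx Idx ℚ) :=
  {σ | σ ∈ Matrix.symplecticGroup (Fin 2) ℚ ∧
    ∃ a b c d : Matrix (Fin 2) (Fin 2) ℤ,
      σ = Matrix.fromBlocks
        !![(a 0 0 : ℚ), N * a 0 1; a 1 0, a 1 1]
        !![(b 0 0 : ℚ), b 0 1; b 1 0, b 1 1 / N]
        !![(c 0 0 : ℚ), N * c 0 1; N * c 1 0, N * c 1 1]
        !![(d 0 0 : ℚ), d 0 1; N * d 1 0, d 1 1]}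

/-- The Jacobi group: the elements of `Sp₂(ℤ)` of the shape
`(*, 0, *, *; *, *, *, *; *, 0, *, *; 0, 0, 0, *)`. -/
def jacobiGroup : Set (Matrix Idx Idx ℤ) :=
  {σ | σ ∈ Matrix.symplecticGroup (Fin 2) ℤ ∧
    ∃ a b c d : Matrix (Fin 2) (Fin 2) ℤ,
      σ = Matrix.fromBlocks
        !![a 0 0, 0; a 1 0, a 1 1]
        !![b 0 0, b 0 1; b 1 0, b 1 1]
        !![c 0 0, 0; 0, 0]
        !![d 0 0, d 0 1; 0, d 1 1]}

/-- The Fricke involution `F_N = N^(-1/2) (0, 1; -N, 0)`. -/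
def fricke (N : ℕ) : Matrix (Fin 2) (Fin 2) ℝ :=
  (1 / Real.sqrt N) • !![0, 1; -(N : ℝ), 0]

/-- The normalizer `μ_N = diag(-F_N', F_N)` of the paramodular group. -/
def mu (N : ℕ) : Matrix Idx Idx ℝ :=
  Matrix.fromBlocks (-(fricke N)ᵀ) 0 0 (fricke N)

/-- The symmetric matrix `(τ, z; z, ω)` with coordinates `p = (τ, z, ω)`. -/
def symMat (p : ℂ × ℂ × ℂ) : Matrix (Fin 2) (Fin 2) ℂ :=
  !![p.1, p.2.1; p.2.1, p.2.2]

/-- Holomorphy of a function on the Siegel upper half space, in the coordinates `(τ, z, ω)`. -/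
def HolomorphicOnH2 (f : Matrix (Fin 2) (Fin 2) ℂ → ℂ) : Prop :=
  DifferentiableOn ℂ (fun p : ℂ × ℂ × ℂ => f (symMat p)) {p | symMat p ∈ siegelH2}

/-- `f ∈ M_k(K(N))`. -/
structure IsParamodularForm (k : ℤ) (N : ℕ) (f : Matrix (Fin 2) (Fin 2) ℂ → ℂ) : Prop where
  holo : HolomorphicOnH2 f
  slash_eq : ∀ σ ∈ paramodularGroup N, ∀ Ω ∈ siegelH2,
    slash k f (σ.map (fun x : ℚ => (x : ℝ))) Ω = f Ω

/-- `f ∈ M_k(K(N))^ε`. -/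
structure IsParamodularEigenform (k : ℤ) (N : ℕ) (ε : ℤ)
    (f : Matrix (Fin 2) (Fin 2) ℂ → ℂ) : Prop extends IsParamodularForm k N f where
  slash_mu : ∀ Ω ∈ siegelH2, slash k f (mu N) Ω = ε * f Ω

/-- The Fourier coefficient `c(n, r; φ)` of a function `φ(τ, z)` with period one in both variables,
computed on `Im τ = 1`, `Im z = 0`. For `φ(τ, z) = ∑ c(n, r) e(nτ + rz)`, absolutely convergent
on `Im τ > 0`, it equals `c(n, r)`. -/
def jacobiCoeff (φ : ℂ × ℂ → ℂ) (n : ℕ) (r : ℤ) : ℂ :=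
  ∫ x in (0 : ℝ)..1, ∫ y in (0 : ℝ)..1,
    φ ((x : ℂ) + Complex.I, (y : ℂ)) *
      e (-((n : ℂ) * ((x : ℂ) + Complex.I) + (r : ℂ) * (y : ℂ)))

/-- The function `φ(τ, z) e(mω)` on the Siegel upper half space. -/
def lift (m : ℕ) (φ : ℂ × ℂ → ℂ) (Ω : Matrix (Fin 2) (Fin 2) ℂ) : ℂ :=
  φ (Ω 0 0, Ω 0 1) * e (m * Ω 1 1)

/-- `φ ∈ J_{k,m}`: Jacobi forms of weight `k` and index `m`. Functions on `ℍ × ℂ` are modelled by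
total functions, of which only the values at `Im τ > 0` are ever used. -/
structure IsJacobiForm (k : ℤ) (m : ℕ) (φ : ℂ × ℂ → ℂ) : Prop where
  holo : DifferentiableOn ℂ φ {p | 0 < p.1.im}
  slash_eq : ∀ σ ∈ jacobiGroup, ∀ Ω ∈ siegelH2,
    slash k (lift m φ) (σ.map (fun x : ℤ => (x : ℝ))) Ω = lift m φ Ω
  fourier : ∀ τ z : ℂ, 0 < τ.im →
    HasSum (fun p : {p : ℕ × ℤ // p.2 ^ 2 ≤ 4 * (m : ℤ) * (p.1 : ℤ)} =>
      jacobiCoeff φ p.1.1 p.1.2 * e ((p.1.1 : ℂ) * τ + (p.1.2 : ℂ) * z)) (φ (τ, z))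

/-- The matrix `(n, r/2; r/2, m)` belongs to the index set `X₂^semi(N)`: it is positive
semidefinite and `N ∣ m`. (Positive semidefiniteness forces `n, m ≥ 0`, so that natural numbers
suffice for these two entries.) -/
def IsSemiIndex (N : ℕ) (n : ℕ) (r : ℤ) (m : ℕ) : Prop :=
  (!![(n : ℝ), (r : ℝ) / 2; (r : ℝ) / 2, (m : ℝ)]).PosSemidef ∧ N ∣ m

/-- The formal series `∑_{N ∣ m} φ_m ξ^m` lies in `∏_{m ≥ 0, N ∣ m} J_{k,m}`. Here and below the
values of the family `φ` at indices not divisible by `N` play no role. -/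
def IsFormalJacobiSeries (k : ℤ) (N : ℕ) (φ : ℕ → ℂ × ℂ → ℂ) : Prop :=
  ∀ m : ℕ, N ∣ m → IsJacobiForm k m (φ m)

/-- The Involution(`ε`) condition. -/
def InvolutionCondition (N : ℕ) (ε : ℤ) (φ : ℕ → ℂ × ℂ → ℂ) : Prop :=
  ∀ (n : ℕ) (r : ℤ) (m : ℕ), IsSemiIndex N n r m →
    jacobiCoeff (φ m) n r = ε * jacobiCoeff (φ (n * N)) (m / N) (-r)

/-- The growth condition. -/
def GrowthCondition (N : ℕ) (φ : ℕ → ℂ × ℂ → ℂ) : Prop :=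
  ∀ ρ : ℝ, 1 < ρ → ∃ A : ℝ, 0 < A ∧ ∀ (n : ℕ) (r : ℤ) (m : ℕ), IsSemiIndex N n r m →
    ‖jacobiCoeff (φ m) n r‖ ≤ A * ρ ^ (n + m)

/-- `∑_{N ∣ m} φ_m ξ^m` is the Fourier-Jacobi expansion of `f`: for every
`Ω = (τ, z; z, ω)` in the Siegel upper half space, `f(Ω) = ∑_{m ≥ 0, N ∣ m} φ_m(τ, z) e(mω)`
(absolute convergence included). This determines the functions `φ_m` on `ℍ × ℂ` from `f`, by the
uniqueness of the coefficients of a convergent power series in `e(ω)`. -/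
def IsFourierJacobiExpansion (N : ℕ) (f : Matrix (Fin 2) (Fin 2) ℂ → ℂ)
    (φ : ℕ → ℂ × ℂ → ℂ) : Prop :=
  ∀ Ω ∈ siegelH2,
    HasSum (fun m : {m : ℕ // N ∣ m} => φ m.1 (Ω 0 0, Ω 0 1) * e ((m.1 : ℂ) * Ω 1 1)) (f Ω)

end Paramodular

end

open Matrix

noncomputable section

namespace Paramodular

/-! Both directions pass through the triple Fourier series of `f` in `τ, z, ω`, with coefficients
`c(n, r; φ_m)`.

From a form to the conditions: Cauchy's estimate on the torus with imaginary part `δ` times the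
identity, where `exp(2πδ) = ρ`, gives the growth condition (`growthCondition_of_expansion`). Growth
makes the triple series absolutely convergent. Since `μ_N` sends `(τ, z, ω)` to `(Nω, -z, τ/N)`, it
permutes the exponentials, and uniqueness of Fourier coefficients turns the eigenvalue equation into
the involution condition.

From the conditions to a form: growth makes the series converge locally uniformly to a holomorphic
function (`exists_summable_bound`). This function is invariant under the Jacobi group, because each
Fourier-Jacobi term is, and under `ω ↦ ω + s/N`, because only multiples of `N` occur as indices; the
involution condition makes it an eigenfunction of `μ_N`. Its stabilizer is therefore normalised by
`μ_N`, and such a group contains `K(N)` (`mem_of_mem_paramodularGroup`): elementary moves reduce the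
last row of a paramodular matrix, rescaled to be integral, to `(0, 0, 0, 1)`, and what remains is a
Jacobi element times a translation. -/

/-! ### The symplectic action on the Siegel upper half space. -/

/-- The numerator `AΩ + B` of the action of `σ`. -/
def numer (σ : Matrix Idx Idx ℝ) (Ω : Matrix (Fin 2) (Fin 2) ℂ) : Matrix (Fin 2) (Fin 2) ℂ :=
  σ.toBlocks₁₁.map Complex.ofReal * Ω + σ.toBlocks₁₂.map Complex.ofReal

/-- The automorphy factor `CΩ + D`. -/
def denom (σ : Matrix Idx Idx ℝ) (Ω : Matrix (Fin 2) (Fin 2) ℂ) : Matrix (Fin 2) (Fin 2) ℂ :=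
  σ.toBlocks₂₁.map Complex.ofReal * Ω + σ.toBlocks₂₂.map Complex.ofReal

/-- The action `(AΩ + B)(CΩ + D)⁻¹` on the Siegel upper half space. -/
def moebius (σ : Matrix Idx Idx ℝ) (Ω : Matrix (Fin 2) (Fin 2) ℂ) : Matrix (Fin 2) (Fin 2) ℂ :=
  numer σ Ω * (denom σ Ω)⁻¹

theorem slash_apply (k : ℤ) (f : Matrix (Fin 2) (Fin 2) ℂ → ℂ) (σ : Matrix Idx Idx ℝ)
    (Ω : Matrix (Fin 2) (Fin 2) ℂ) :
    slash k f σ Ω = (denom σ Ω).det ^ (-k) * f (moebius σ Ω) := rfl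

theorem posDef_fin_two_iff {Y : Matrix (Fin 2) (Fin 2) ℝ} (hY : Y.IsSymm) :
    Y.PosDef ↔ 0 < Y 0 0 ∧ Y 0 1 ^ 2 < Y 0 0 * Y 1 1 := by
  have h10 : Y 1 0 = Y 0 1 := hY.apply 0 1
  constructor
  · intro h
    have h0 := h.diag_pos (i := 0)
    have h1 := h.det_pos
    rw [det_fin_two, h10] at h1
    exact ⟨h0, by nlinarith⟩
  · rintro ⟨h0, h1⟩
    refine PosDef.of_dotProduct_mulVec_pos ?_ ?_
    · rw [IsHermitian, conjTranspose_eq_transpose_of_trivial]; exact hY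
    · intro x hx
      have hx' : x 0 ≠ 0 ∨ x 1 ≠ 0 := by
        by_contra! h
        exact hx (by ext i; fin_cases i <;> simp [h])
      simp only [dotProduct, mulVec, Fin.sum_univ_two, star_trivial, h10]
      have key : 0 < Y 0 0 * (x 0 * (Y 0 0 * x 0 + Y 0 1 * x 1) +
          x 1 * (Y 0 1 * x 0 + Y 1 1 * x 1)) := by
        have e1 : Y 0 0 * (x 0 * (Y 0 0 * x 0 + Y 0 1 * x 1) +
          x 1 * (Y 0 1 * x 0 + Y 1 1 * x 1)) = (Y 0 0 * x 0 + Y 0 1 * x 1) ^ 2 +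
            (Y 0 0 * Y 1 1 - Y 0 1 ^ 2) * x 1 ^ 2 := by ring
        rw [e1]
        by_cases hx1 : x 1 = 0
        · have : x 0 ≠ 0 := by tauto
          have h2 : 0 < (Y 0 0 * x 0) ^ 2 := by positivity
          simpa [hx1] using h2
        · have := sub_pos.2 h1
          positivity
      exact pos_of_mul_pos_right key h0.le

theorem mem_siegelH2_iff {Ω : Matrix (Fin 2) (Fin 2) ℂ} (hΩ : Ω.IsSymm) :
    Ω ∈ siegelH2 ↔ 0 < (Ω 0 0).im ∧ (Ω 0 1).im ^ 2 < (Ω 0 0).im * (Ω 1 1).im := by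
  rw [siegelH2, Set.mem_ofPred_eq, posDef_fin_two_iff (hΩ.map _)]
  simp [hΩ]

theorem symMat_isSymm (p : ℂ × ℂ × ℂ) : (symMat p).IsSymm := by
  ext i j
  fin_cases i <;> fin_cases j <;> rfl

theorem symMat_mem_iff (p : ℂ × ℂ × ℂ) :
    symMat p ∈ siegelH2 ↔ 0 < p.1.im ∧ p.2.1.im ^ 2 < p.1.im * p.2.2.im := by
  rw [mem_siegelH2_iff (symMat_isSymm p)]
  simp [symMat]

theorem eq_symMat {Ω : Matrix (Fin 2) (Fin 2) ℂ} (hΩ : Ω.IsSymm) :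
    Ω = symMat (Ω 0 0, Ω 0 1, Ω 1 1) := by
  ext i j
  fin_cases i <;> fin_cases j <;> simp [symMat]
  exact hΩ.apply 0 1

/-- The Hermitian form attached to the imaginary part of `Ω`. -/
def imForm (Ω : Matrix (Fin 2) (Fin 2) ℂ) (v : Fin 2 → ℂ) : ℝ :=
  (star v ⬝ᵥ ((Ω - Ωᴴ) *ᵥ v)).im

theorem imForm_eq {Ω : Matrix (Fin 2) (Fin 2) ℂ} (hΩ : Ω.IsSymm) (v : Fin 2 → ℂ) :
    imForm Ω v = 2 * ((fun i => (v i).re) ⬝ᵥ (Ω.map Complex.im *ᵥ fun i => (v i).re)) +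
      2 * ((fun i => (v i).im) ⬝ᵥ (Ω.map Complex.im *ᵥ fun i => (v i).im)) := by
  have h10 : Ω 1 0 = Ω 0 1 := hΩ.apply 0 1
  simp [imForm, dotProduct, mulVec, Fin.sum_univ_two, h10]
  ring

theorem mem_siegelH2_iff_imForm {Ω : Matrix (Fin 2) (Fin 2) ℂ} (hΩ : Ω.IsSymm) :
    Ω ∈ siegelH2 ↔ ∀ v ≠ 0, 0 < imForm Ω v := by
  constructor
  · rintro ⟨-, h⟩ v hv
    rw [imForm_eq hΩ]
    have hnn (x : Fin 2 → ℝ) : 0 ≤ x ⬝ᵥ (Ω.map Complex.im *ᵥ x) := by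
      simpa using h.posSemidef.dotProduct_mulVec_nonneg x
    have hpos (x : Fin 2 → ℝ) (hx : x ≠ 0) : 0 < x ⬝ᵥ (Ω.map Complex.im *ᵥ x) := by
      simpa using h.dotProduct_mulVec_pos hx
    by_cases h1 : (fun i => (v i).re) = 0
    · have h2 : (fun i => (v i).im) ≠ 0 := fun h2 =>
        hv (funext fun i => Complex.ext (congrFun h1 i) (congrFun h2 i))
      linarith [hnn (fun i => (v i).re), hpos _ h2]
    · linarith [hnn (fun i => (v i).im), hpos _ h1]
  · intro h
    refine ⟨hΩ, PosDef.of_dotProduct_mulVec_pos ?_ fun x hx => ?_⟩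
    · rw [IsHermitian, conjTranspose_eq_transpose_of_trivial]; exact hΩ.map _
    · have := h (fun i => (x i : ℂ)) fun h0 => hx (funext fun i => by simpa using congrFun h0 i)
      rw [imForm_eq hΩ] at this
      simp only [Complex.ofReal_re, Complex.ofReal_im] at this
      have h0 : (fun _ : Fin 2 => (0 : ℝ)) = 0 := rfl
      rw [h0, zero_dotProduct, mul_zero, add_zero] at this
      simpa using this

theorem blocks_mem {σ : Matrix Idx Idx ℝ} (hσ : σ ∈ symplecticGroup (Fin 2) ℝ) :
    let A := σ.toBlocks₁₁.map Complex.ofReal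
    let B := σ.toBlocks₁₂.map Complex.ofReal
    let C := σ.toBlocks₂₁.map Complex.ofReal
    let D := σ.toBlocks₂₂.map Complex.ofReal
    Aᵀ * C = Cᵀ * A ∧ Bᵀ * D = Dᵀ * B ∧ Aᵀ * D - Cᵀ * B = 1 := by
  intro A B C D
  have h := SymplecticGroup.map_mem hσ Complex.ofRealHom
  rw [← fromBlocks_toBlocks σ, fromBlocks_map] at h
  exact SymplecticGroup.fromBlocks_mem_iff.1 h

/-- The free matrix `P` serves twice: `P = Ωᴴ` shows how the imaginary part transforms, `P = Ω`
shows that symmetry is preserved. -/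
theorem symplectic_identity {A B C D : Matrix (Fin 2) (Fin 2) ℂ}
    (h : Aᵀ * C = Cᵀ * A ∧ Bᵀ * D = Dᵀ * B ∧ Aᵀ * D - Cᵀ * B = 1)
    (P Ω : Matrix (Fin 2) (Fin 2) ℂ) :
    (P * Aᵀ + Bᵀ) * (C * Ω + D) - (P * Cᵀ + Dᵀ) * (A * Ω + B) = P - Ω := by
  obtain ⟨h1, h2, h3⟩ := h
  have h4 : Dᵀ * A - Bᵀ * C = 1 := by simpa using congrArg transpose h3
  calc _ = P * (Aᵀ * C - Cᵀ * A) * Ω + P * (Aᵀ * D - Cᵀ * B) - (Dᵀ * A - Bᵀ * C) * Ω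
        + (Bᵀ * D - Dᵀ * B) := by noncomm_ring
    _ = P - Ω := by rw [h1, h2, h3, h4]; simp

theorem conjTranspose_map_ofReal (A : Matrix (Fin 2) (Fin 2) ℝ) :
    (A.map Complex.ofReal)ᴴ = (A.map Complex.ofReal)ᵀ := by
  ext i j
  simp

theorem numer_conjTranspose_mul_denom {σ : Matrix Idx Idx ℝ} (hσ : σ ∈ symplecticGroup (Fin 2) ℝ)
    (Ω : Matrix (Fin 2) (Fin 2) ℂ) :
    (denom σ Ω)ᴴ * numer σ Ω - (numer σ Ω)ᴴ * denom σ Ω = Ω - Ωᴴ := by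
  rw [← neg_inj, neg_sub, neg_sub, ← symplectic_identity (blocks_mem hσ) Ωᴴ Ω]
  simp [numer, denom, conjTranspose_map_ofReal]

theorem numer_transpose_mul_denom {σ : Matrix Idx Idx ℝ} (hσ : σ ∈ symplecticGroup (Fin 2) ℝ)
    {Ω : Matrix (Fin 2) (Fin 2) ℂ} (hΩ : Ω.IsSymm) :
    (numer σ Ω)ᵀ * denom σ Ω = (denom σ Ω)ᵀ * numer σ Ω := by
  rw [← sub_eq_zero, ← sub_self Ω, ← symplectic_identity (blocks_mem hσ) Ω Ω]
  simp [numer, denom, hΩ.eq]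

theorem imForm_mulVec {j n : Matrix (Fin 2) (Fin 2) ℂ} (v : Fin 2 → ℂ) :
    star v ⬝ᵥ ((jᴴ * n - nᴴ * j) *ᵥ v) =
      star (j *ᵥ v) ⬝ᵥ (n *ᵥ v) - star (n *ᵥ v) ⬝ᵥ (j *ᵥ v) := by
  rw [sub_mulVec, dotProduct_sub, star_mulVec, star_mulVec, ← dotProduct_mulVec,
    ← dotProduct_mulVec, mulVec_mulVec, mulVec_mulVec]

/-- A vector killed by `CΩ + D` would be isotropic for the positive definite form `imForm Ω`. -/
theorem det_denom_ne_zero {σ : Matrix Idx Idx ℝ} (hσ : σ ∈ symplecticGroup (Fin 2) ℝ)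
    {Ω : Matrix (Fin 2) (Fin 2) ℂ} (hΩ : Ω ∈ siegelH2) : (denom σ Ω).det ≠ 0 := by
  intro h
  obtain ⟨v, hv, hv0⟩ := exists_mulVec_eq_zero_iff.2 h
  have := (mem_siegelH2_iff_imForm hΩ.1).1 hΩ v hv
  rw [imForm, ← numer_conjTranspose_mul_denom hσ, imForm_mulVec, hv0] at this
  simp at this

/-- With `u = (CΩ + D)w`, the form of the image at `u` equals the form of `Ω` at `w`. -/
theorem moebius_mem {σ : Matrix Idx Idx ℝ} (hσ : σ ∈ symplecticGroup (Fin 2) ℝ)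
    {Ω : Matrix (Fin 2) (Fin 2) ℂ} (hΩ : Ω ∈ siegelH2) : moebius σ Ω ∈ siegelH2 := by
  have hu : IsUnit (denom σ Ω).det := (det_denom_ne_zero hσ hΩ).isUnit
  have hut : IsUnit (denom σ Ω)ᵀ.det := by rwa [det_transpose]
  have hsymm : (moebius σ Ω).IsSymm := by
    have h := numer_transpose_mul_denom hσ hΩ.1
    rw [IsSymm, moebius, transpose_mul, transpose_nonsing_inv]
    calc _ = ((denom σ Ω)ᵀ)⁻¹ * ((numer σ Ω)ᵀ * denom σ Ω) * (denom σ Ω)⁻¹ := by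
          rw [Matrix.mul_assoc, mul_nonsing_inv_cancel_right _ _ hu]
      _ = _ := by rw [h, nonsing_inv_mul_cancel_left _ _ hut]
  rw [mem_siegelH2_iff_imForm hsymm]
  intro u hu0
  set w := (denom σ Ω)⁻¹ *ᵥ u with hw
  have hjw : denom σ Ω *ᵥ w = u := by rw [hw, mulVec_mulVec, mul_nonsing_inv _ hu, one_mulVec]
  have hw0 : w ≠ 0 := by
    rintro h
    rw [h, mulVec_zero] at hjw
    exact hu0 hjw.symm
  have := (mem_siegelH2_iff_imForm hΩ.1).1 hΩ w hw0
  rw [imForm, ← numer_conjTranspose_mul_denom hσ, imForm_mulVec, hjw] at this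
  have hn : numer σ Ω *ᵥ w = moebius σ Ω *ᵥ u := by rw [hw, mulVec_mulVec, moebius]
  rw [hn] at this
  have h1 := imForm_mulVec (j := 1) (n := moebius σ Ω) u
  rw [conjTranspose_one, Matrix.one_mul, Matrix.mul_one, one_mulVec] at h1
  rw [imForm, h1]
  exact this

theorem denom_mul {σ τ : Matrix Idx Idx ℝ} {Ω : Matrix (Fin 2) (Fin 2) ℂ}
    (h : IsUnit (denom τ Ω).det) :
    denom (σ * τ) Ω = denom σ (moebius τ Ω) * denom τ Ω := by
  have h2 : moebius τ Ω * denom τ Ω = numer τ Ω := nonsing_inv_mul_cancel_right _ _ h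
  rw [denom.eq_def σ, Matrix.add_mul, Matrix.mul_assoc, h2]
  conv_lhs => rw [← fromBlocks_toBlocks σ, ← fromBlocks_toBlocks τ, fromBlocks_multiply]
  simp only [denom, numer, toBlocks_fromBlocks₂₁, toBlocks_fromBlocks₂₂]
  rw [Matrix.map_add _ Complex.ofReal_add, Matrix.map_add _ Complex.ofReal_add]
  simp only [show (Complex.ofReal : ℝ → ℂ) = Complex.ofRealHom from rfl, Matrix.map_mul]
  noncomm_ring

theorem numer_mul {σ τ : Matrix Idx Idx ℝ} {Ω : Matrix (Fin 2) (Fin 2) ℂ}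
    (h : IsUnit (denom τ Ω).det) :
    numer (σ * τ) Ω = numer σ (moebius τ Ω) * denom τ Ω := by
  have h2 : moebius τ Ω * denom τ Ω = numer τ Ω := nonsing_inv_mul_cancel_right _ _ h
  rw [numer.eq_def σ, Matrix.add_mul, Matrix.mul_assoc, h2]
  conv_lhs => rw [← fromBlocks_toBlocks σ, ← fromBlocks_toBlocks τ, fromBlocks_multiply]
  simp only [denom, numer, toBlocks_fromBlocks₁₁, toBlocks_fromBlocks₁₂]
  rw [Matrix.map_add _ Complex.ofReal_add, Matrix.map_add _ Complex.ofReal_add]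
  simp only [show (Complex.ofReal : ℝ → ℂ) = Complex.ofRealHom from rfl, Matrix.map_mul]
  noncomm_ring

theorem moebius_mul {σ τ : Matrix Idx Idx ℝ} {Ω : Matrix (Fin 2) (Fin 2) ℂ}
    (h : IsUnit (denom τ Ω).det) : moebius (σ * τ) Ω = moebius σ (moebius τ Ω) := by
  rw [moebius, denom_mul h, numer_mul h, Matrix.mul_inv_rev, moebius.eq_def σ, Matrix.mul_assoc,
    mul_nonsing_inv_cancel_left _ _ h]

theorem moebius_one (Ω : Matrix (Fin 2) (Fin 2) ℂ) : moebius 1 Ω = Ω := by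
  simp [moebius, numer, denom, ← fromBlocks_one]

theorem denom_one (Ω : Matrix (Fin 2) (Fin 2) ℂ) : denom 1 Ω = 1 := by
  simp [denom, ← fromBlocks_one]

theorem slash_one (k : ℤ) (f : Matrix (Fin 2) (Fin 2) ℂ → ℂ) (Ω : Matrix (Fin 2) (Fin 2) ℂ) :
    slash k f 1 Ω = f Ω := by
  simp [slash_apply, moebius_one, denom_one]

theorem slash_mul (k : ℤ) (f : Matrix (Fin 2) (Fin 2) ℂ → ℂ) (σ : Matrix Idx Idx ℝ)
    {τ : Matrix Idx Idx ℝ} (hτ : τ ∈ symplecticGroup (Fin 2) ℝ)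
    {Ω : Matrix (Fin 2) (Fin 2) ℂ} (hΩ : Ω ∈ siegelH2) :
    slash k f (σ * τ) Ω = (denom τ Ω).det ^ (-k) * slash k f σ (moebius τ Ω) := by
  have h := (det_denom_ne_zero hτ hΩ).isUnit
  rw [slash_apply, slash_apply, moebius_mul h, denom_mul h, det_mul, mul_zpow]
  ring

/-! ### Stabilizers under the slash action. -/

/-- The symplectic matrices that multiply `f` by a sign `±1` under the slash action. -/
def signStabilizer (k : ℤ) (f : Matrix (Fin 2) (Fin 2) ℂ → ℂ) :
    Subgroup (symplecticGroup (Fin 2) ℝ × ℤˣ) where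
  carrier := {σ | ∀ Ω ∈ siegelH2, slash k f σ.1.1 Ω = ((σ.2 : ℤ) : ℂ) * f Ω}
  one_mem' Ω _ := by simp [slash_one]
  mul_mem' {σ τ} hσ hτ Ω hΩ := by
    have := hτ Ω hΩ
    rw [slash_apply] at this
    have h2 : ((σ * τ).1 : Matrix Idx Idx ℝ) = σ.1.1 * τ.1.1 := rfl
    rw [h2, slash_mul k f _ τ.1.2 hΩ, hσ _ (moebius_mem τ.1.2 hΩ), mul_left_comm, this]
    simp [mul_assoc]
  inv_mem' {σ} hσ Ω hΩ := by
    have hm := moebius_mem (σ⁻¹).1.2 hΩ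
    have h1 := slash_mul k f σ.1.1 (σ⁻¹).1.2 hΩ
    have h2 : σ.1.1 * (σ⁻¹).1.1 = 1 := congrArg Subtype.val (mul_inv_cancel σ.1)
    rw [h2, slash_one, hσ _ hm, mul_left_comm, ← slash_apply] at h1
    rw [h1, ← mul_assoc]
    rcases Int.units_eq_one_or σ.2 with h | h <;> simp [h]

/-- The symplectic matrices that stabilize `f` under the slash action. -/
def stabilizer (k : ℤ) (f : Matrix (Fin 2) (Fin 2) ℂ → ℂ) :
    Subgroup (symplecticGroup (Fin 2) ℝ) :=
  (signStabilizer k f).comap ((MonoidHom.id _).prod 1)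

theorem mem_stabilizer {k : ℤ} {f : Matrix (Fin 2) (Fin 2) ℂ → ℂ}
    {σ : symplecticGroup (Fin 2) ℝ} :
    σ ∈ stabilizer k f ↔ ∀ Ω ∈ siegelH2, slash k f σ.1 Ω = f Ω := by
  change (∀ Ω ∈ siegelH2, slash k f σ.1 Ω = (((1 : ℤˣ) : ℤ) : ℂ) * f Ω) ↔ _
  simp

/-- The sign of `μ` cancels against that of `μ⁻¹`, so an eigenform with either sign has a stabilizer
closed under this conjugation. -/
theorem conj_mem_stabilizer {k : ℤ} {f : Matrix (Fin 2) (Fin 2) ℂ → ℂ}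
    {μ : symplecticGroup (Fin 2) ℝ} {ε : ℤˣ}
    (hμ : ∀ Ω ∈ siegelH2, slash k f μ.1 Ω = ((ε : ℤ) : ℂ) * f Ω)
    {σ : symplecticGroup (Fin 2) ℝ} (hσ : σ ∈ stabilizer k f) :
    μ * σ * μ⁻¹ ∈ stabilizer k f := by
  have h1 : (μ, ε) ∈ signStabilizer k f := hμ
  have h2 := mul_mem (mul_mem h1 hσ) (inv_mem h1)
  simpa [stabilizer, Subgroup.mem_comap] using h2

/-! ### The involution `μ_N` and an integral model of `K(N)`. -/

theorem fricke_mul_self {N : ℕ} (hN : 0 < N) : fricke N * fricke N = -1 := by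
  have h1 : (0 : ℝ) < N := by exact_mod_cast hN
  have h2 : (1 / Real.sqrt N) * (1 / Real.sqrt N) * N = 1 := by
    rw [div_mul_div_comm, Real.mul_self_sqrt h1.le, one_mul, one_div_mul_cancel h1.ne']
  ext i j
  fin_cases i <;> fin_cases j <;> simp [fricke, Matrix.mul_apply] <;>
    simp only [one_div] at h2 <;> linarith

theorem mu_mem {N : ℕ} (hN : 0 < N) : mu N ∈ symplecticGroup (Fin 2) ℝ := by
  rw [mu, SymplecticGroup.fromBlocks_mem_iff]
  simp [fricke_mul_self hN]

/-- The involution `μ_N` as an element of the symplectic group. -/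
def muSp {N : ℕ} (hN : 0 < N) : symplecticGroup (Fin 2) ℝ := ⟨mu N, mu_mem hN⟩

theorem coe_muSp_inv {N : ℕ} (hN : 0 < N) : ((muSp hN)⁻¹).1 = -mu N := by
  have h : mu N * (-mu N) = 1 := by
    have h2 := congrArg transpose (fricke_mul_self hN)
    rw [transpose_mul] at h2
    simp [mu, fromBlocks_multiply, fricke_mul_self hN, fromBlocks_neg, h2]
  exact (SymplecticGroup.coe_inv' _).trans (inv_eq_right_inv h)

/-- A multiple of `μ_N` with integral entries. -/
def muInt (N : ℕ) : Matrix Idx Idx ℝ :=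
  fromBlocks !![0, N; -1, 0] 0 0 !![0, 1; -N, 0]

theorem mu_eq_smul (N : ℕ) : mu N = (1 / Real.sqrt N) • muInt N := by
  rw [mu, muInt, fromBlocks_smul, fricke]
  congr 1
  · ext i j
    fin_cases i <;> fin_cases j <;> simp
  · simp
  · simp

/-- The diagonal matrix that conjugates the paramodular group into the integral matrices. -/
def scaling (N : ℕ) : Matrix Idx Idx ℝ := fromBlocks 1 0 0 !![1, 0; 0, N]

/-- The paramodular matrix `σ` is conjugate to the integral matrix `Z`. -/
structure IsRep (N : ℕ) (σ : symplecticGroup (Fin 2) ℝ) (Z : Matrix Idx Idx ℤ) : Prop where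
  eq : σ.1 * scaling N = scaling N * Z.map (fun x : ℤ => (x : ℝ))
  dvd₁₁ : (N : ℤ) ∣ Z.toBlocks₁₁ 0 1
  dvd₁₂ : (N : ℤ) ∣ Z.toBlocks₁₂ 0 1
  dvd₂₁ : (N : ℤ) ∣ Z.toBlocks₂₁ 0 1
  dvd₂₂ : (N : ℤ) ∣ Z.toBlocks₂₂ 0 1

/-- The divisibility concerns one off-diagonal block for the splitting of the coordinates into index
`0` and index `1`: block triangularity modulo `N`, which products preserve. -/
theorem IsRep.mul {N : ℕ} {σ τ : symplecticGroup (Fin 2) ℝ} {Z Y : Matrix Idx Idx ℤ}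
    (h : IsRep N σ Z) (h' : IsRep N τ Y) : IsRep N (σ * τ) (Z * Y) where
  eq := by
    have hm : (Z * Y).map (fun x : ℤ => (x : ℝ)) =
        Z.map (fun x : ℤ => (x : ℝ)) * Y.map (fun x : ℤ => (x : ℝ)) :=
      Matrix.map_mul (f := Int.castRingHom ℝ)
    have hc : (σ * τ).1 = σ.1 * τ.1 := rfl
    rw [hm, hc, Matrix.mul_assoc, h'.eq, ← Matrix.mul_assoc, h.eq, Matrix.mul_assoc]
  dvd₁₁ := by
    have h1 := h.dvd₁₁; have h2 := h.dvd₁₂; have h3 := h'.dvd₁₁; have h4 := h'.dvd₂₁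
    simp only [toBlocks₁₁, toBlocks₁₂, toBlocks₂₁, of_apply, Matrix.mul_apply,
      Fintype.sum_sum_type, Fin.sum_univ_two] at *
    exact dvd_add (dvd_add (h3.mul_left _) (h1.mul_right _))
      (dvd_add (h4.mul_left _) (h2.mul_right _))
  dvd₁₂ := by
    have h1 := h.dvd₁₁; have h2 := h.dvd₁₂; have h3 := h'.dvd₁₂; have h4 := h'.dvd₂₂
    simp only [toBlocks₁₁, toBlocks₁₂, toBlocks₂₂, of_apply, Matrix.mul_apply,
      Fintype.sum_sum_type, Fin.sum_univ_two] at *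
    exact dvd_add (dvd_add (h3.mul_left _) (h1.mul_right _))
      (dvd_add (h4.mul_left _) (h2.mul_right _))
  dvd₂₁ := by
    have h1 := h.dvd₂₁; have h2 := h.dvd₂₂; have h3 := h'.dvd₁₁; have h4 := h'.dvd₂₁
    simp only [toBlocks₁₁, toBlocks₂₂, toBlocks₂₁, of_apply, Matrix.mul_apply,
      Fintype.sum_sum_type, Fin.sum_univ_two] at *
    exact dvd_add (dvd_add (h3.mul_left _) (h1.mul_right _))
      (dvd_add (h4.mul_left _) (h2.mul_right _))
  dvd₂₂ := by
    have h1 := h.dvd₂₁; have h2 := h.dvd₂₂; have h3 := h'.dvd₁₂; have h4 := h'.dvd₂₂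
    simp only [toBlocks₂₁, toBlocks₁₂, toBlocks₂₂, of_apply, Matrix.mul_apply,
      Fintype.sum_sum_type, Fin.sum_univ_two] at *
    exact dvd_add (dvd_add (h3.mul_left _) (h1.mul_right _))
      (dvd_add (h4.mul_left _) (h2.mul_right _))

/-- Membership of `μ_N σ μ_N⁻¹` in a conjugate of the integral matrices. -/
theorem conj_eq {N : ℕ} (hN : 0 < N) {σ : symplecticGroup (Fin 2) ℝ} {Y : Matrix Idx Idx ℝ}
    (h : muInt N * σ.1 * muInt N * scaling N = -(N : ℝ) • (scaling N * Y)) :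
    (muSp hN * σ * (muSp hN)⁻¹).1 * scaling N = scaling N * Y := by
  have h1 : (0 : ℝ) < N := by exact_mod_cast hN
  have hc : (muSp hN * σ * (muSp hN)⁻¹).1 = -(mu N * σ.1 * mu N) := by
    change mu N * σ.1 * ((muSp hN)⁻¹).1 = _
    rw [coe_muSp_inv, Matrix.mul_neg]
  -- The two factors `1/√N` combine to `1/N`, so the square root disappears from the conjugate.
  rw [hc, mu_eq_smul, smul_mul_assoc, smul_mul_assoc, mul_smul_comm, smul_smul, div_mul_div_comm,
    Real.mul_self_sqrt h1.le, Matrix.neg_mul, smul_mul_assoc, h, smul_smul, ← neg_smul]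
  convert one_smul ℝ _ using 2
  field_simp

/-! ### Generation of `K(N)` by row reduction. -/

/-- `SL₂(ℤ)` acting on the first and third coordinates. -/
def sl13 (g : SpecialLinearGroup (Fin 2) ℤ) : Matrix Idx Idx ℤ :=
  fromBlocks !![g.1 0 0, 0; 0, 1] !![g.1 0 1, 0; 0, 0] !![g.1 1 0, 0; 0, 0] !![g.1 1 1, 0; 0, 1]

/-- `SL₂(ℤ)` acting on the second and fourth coordinates. -/
def sl24 (g : SpecialLinearGroup (Fin 2) ℤ) : Matrix Idx Idx ℤ :=
  fromBlocks !![1, 0; 0, g.1 0 0] !![0, 0; 0, g.1 0 1] !![0, 0; 0, g.1 1 0] !![1, 0; 0, g.1 1 1]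

/-- A unipotent element of the Jacobi group. -/
def heis (l : ℤ) : Matrix Idx Idx ℤ :=
  fromBlocks !![1, 0; l, 1] 0 0 !![1, -l; 0, 1]

/-- The conjugate of `heis l` under `μ_N`. -/
def heisConj (N : ℕ) (l : ℤ) : Matrix Idx Idx ℤ :=
  fromBlocks !![1, -(N * l); 0, 1] 0 0 !![1, 0; l, 1]

theorem sl13_mem (g : SpecialLinearGroup (Fin 2) ℤ) : sl13 g ∈ jacobiGroup := by
  refine ⟨?_, !![g.1 0 0, 0; 0, 1], !![g.1 0 1, 0; 0, 0], !![g.1 1 0, 0; 0, 0],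
    !![g.1 1 1, 0; 0, 1], by simp [sl13]⟩
  have hd := g.2
  rw [det_fin_two] at hd
  rw [sl13, SymplecticGroup.fromBlocks_mem_iff]
  refine ⟨?_, ?_, ?_⟩ <;> ext i j <;> fin_cases i <;> fin_cases j <;>
    simp [Matrix.mul_apply] <;> linarith

theorem heis_mem (l : ℤ) : heis l ∈ jacobiGroup := by
  refine ⟨?_, !![1, 0; l, 1], 0, 0, !![1, -l; 0, 1], ?_⟩
  · rw [heis, SymplecticGroup.fromBlocks_mem_iff]
    refine ⟨?_, ?_, ?_⟩ <;> ext i j <;> fin_cases i <;> fin_cases j <;>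
      simp [Matrix.mul_apply]
  · rw [heis, fromBlocks_inj]
    refine ⟨?_, ?_, ?_, ?_⟩ <;> ext i j <;> fin_cases i <;> fin_cases j <;> simp

/-- The real symplectic matrix underlying an element of the Jacobi group. -/
def jacobiSp (γ : Matrix Idx Idx ℤ) (h : γ ∈ jacobiGroup) : symplecticGroup (Fin 2) ℝ :=
  ⟨γ.map (fun x : ℤ => (x : ℝ)), SymplecticGroup.map_mem h.1 (Int.castRingHom ℝ)⟩

theorem map_fin_two {α β : Type*} (f : α → β) (a b c d : α) :
    !![a, b; c, d].map f = !![f a, f b; f c, f d] := by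
  ext i j
  fin_cases i <;> fin_cases j <;> rfl

theorem sl13_isRep (N : ℕ) (g : SpecialLinearGroup (Fin 2) ℤ) :
    IsRep N (jacobiSp _ (sl13_mem g)) (sl13 g) := by
  refine ⟨?_, ?_, ?_, ?_, ?_⟩
  · simp [jacobiSp, sl13, scaling, fromBlocks_map, map_fin_two, fromBlocks_multiply]
    ext i
    fin_cases i <;> rfl
  all_goals simp [sl13]

theorem sl24_isRep {N : ℕ} (hN : 0 < N) (g : SpecialLinearGroup (Fin 2) ℤ) :
    IsRep N (muSp hN * jacobiSp _ (sl13_mem g) * (muSp hN)⁻¹) (sl24 g) := by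
  refine ⟨conj_eq hN ?_, ?_, ?_, ?_, ?_⟩
  · simp only [jacobiSp, sl13, sl24, muInt, scaling, fromBlocks_map, map_fin_two,
      fromBlocks_multiply, Matrix.mul_zero, Matrix.zero_mul, Matrix.one_mul, Matrix.mul_one, add_zero,
      zero_add, mul_fin_two,
      fromBlocks_smul, fromBlocks_inj]
    refine ⟨?_, ?_, ?_, ?_⟩ <;> ext i j <;> fin_cases i <;> fin_cases j <;>
      simp <;> ring
  all_goals simp [sl24]

theorem heisConj_isRep {N : ℕ} (hN : 0 < N) (l : ℤ) :
    IsRep N (muSp hN * jacobiSp _ (heis_mem l) * (muSp hN)⁻¹) (heisConj N l) := by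
  refine ⟨conj_eq hN ?_, ?_, ?_, ?_, ?_⟩
  · simp only [jacobiSp, heis, heisConj, muInt, scaling, fromBlocks_map, map_fin_two,
      fromBlocks_multiply, Matrix.mul_zero, Matrix.zero_mul, Matrix.one_mul, Matrix.mul_one, add_zero,
      zero_add, mul_fin_two,
      fromBlocks_smul, fromBlocks_inj]
    refine ⟨?_, ?_, ?_, ?_⟩ <;> ext i j <;> fin_cases i <;> fin_cases j <;>
      simp [Matrix.mul_apply] <;> ring
  all_goals simp [heisConj]

/-- The translation of `ω` by `s`. -/
def transl (s : ℝ) : symplecticGroup (Fin 2) ℝ :=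
  ⟨fromBlocks 1 !![0, 0; 0, s] 0 1, by
    rw [SymplecticGroup.fromBlocks_mem_iff]
    refine ⟨?_, ?_, ?_⟩ <;> ext i j <;> fin_cases i <;> fin_cases j <;> simp⟩

/-- All paramodular matrices whose integral conjugate has last row `(a, b, c, d)` (in the order of
the columns `inl 0, inl 1, inr 0, inr 1`) lie in `S`. -/
def RowMem (N : ℕ) (S : Subgroup (symplecticGroup (Fin 2) ℝ)) (a b c d : ℤ) : Prop :=
  ∀ σ Z, IsRep N σ Z → Z.toBlocks₂₁ 1 0 = a → Z.toBlocks₂₁ 1 1 = b → Z.toBlocks₂₂ 1 0 = c →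
    Z.toBlocks₂₂ 1 1 = d → σ ∈ S

/-- Right multiplication by an element of `S` does not affect membership in `S`, while the last row
gets multiplied by `Y`. -/
theorem RowMem.of_mul {N : ℕ} {S : Subgroup (symplecticGroup (Fin 2) ℝ)} {a b c d : ℤ}
    {τ : symplecticGroup (Fin 2) ℝ} {Y : Matrix Idx Idx ℤ} (hτ : τ ∈ S) (hY : IsRep N τ Y)
    (h : RowMem N S
      (a * Y.toBlocks₁₁ 0 0 + b * Y.toBlocks₁₁ 1 0 + (c * Y.toBlocks₂₁ 0 0 + d * Y.toBlocks₂₁ 1 0))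
      (a * Y.toBlocks₁₁ 0 1 + b * Y.toBlocks₁₁ 1 1 + (c * Y.toBlocks₂₁ 0 1 + d * Y.toBlocks₂₁ 1 1))
      (a * Y.toBlocks₁₂ 0 0 + b * Y.toBlocks₁₂ 1 0 + (c * Y.toBlocks₂₂ 0 0 + d * Y.toBlocks₂₂ 1 0))
      (a * Y.toBlocks₁₂ 0 1 + b * Y.toBlocks₁₂ 1 1 +
        (c * Y.toBlocks₂₂ 0 1 + d * Y.toBlocks₂₂ 1 1))) :
    RowMem N S a b c d := by
  rintro σ Z hZ rfl rfl rfl rfl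
  have := h (σ * τ) (Z * Y) (hZ.mul hY)
    (by simp [toBlocks₁₁, toBlocks₂₁, toBlocks₂₂, Matrix.mul_apply])
    (by simp [toBlocks₁₁, toBlocks₂₁, toBlocks₂₂, Matrix.mul_apply])
    (by simp [toBlocks₁₂, toBlocks₂₁, toBlocks₂₂, Matrix.mul_apply])
    (by simp [toBlocks₁₂, toBlocks₂₁, toBlocks₂₂, Matrix.mul_apply])
  exact (Subgroup.mul_mem_cancel_right S hτ).1 this

/-- Every pair of integers can be moved to `(0, gcd)` by `SL₂(ℤ)` acting on rows. -/
theorem exists_sl_row_eq (a b : ℤ) : ∃ (g : SpecialLinearGroup (Fin 2) ℤ),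
    a * g.1 0 0 + b * g.1 1 0 = 0 ∧ a * g.1 0 1 + b * g.1 1 1 = Int.gcd a b := by
  by_cases h : Int.gcd a b = 0
  · obtain ⟨rfl, rfl⟩ := Int.gcd_eq_zero_iff.1 h
    exact ⟨1, by simp⟩
  · obtain ⟨a', b', hab, ha, hb⟩ := Int.exists_gcd_one (Nat.pos_of_ne_zero h)
    obtain ⟨u, v, huv⟩ := Int.isCoprime_iff_gcd_eq_one.2 hab
    -- The first column annihilates the row, and the second is a Bézout pair for its primitive part.
    set g := (Int.gcd a b : ℤ)
    refine ⟨⟨!![b', u; -a', v], by rw [det_fin_two_of]; linarith⟩, ?_, ?_⟩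
    · simp only [of_apply, cons_val', cons_val_zero, cons_val_one, cons_val_fin_one]
      rw [ha, hb]; ring
    · simp only [of_apply, cons_val', cons_val_zero, cons_val_one, cons_val_fin_one]
      linear_combination g * huv + u * ha + v * hb

section Generation

variable {N : ℕ} (hN : 0 < N) {S : Subgroup (symplecticGroup (Fin 2) ℝ)}
  (hJ : ∀ γ, ∀ h : γ ∈ jacobiGroup, jacobiSp γ h ∈ S)
  (hμ : ∀ σ ∈ S, muSp hN * σ * (muSp hN)⁻¹ ∈ S)
  (hT : ∀ s : ℤ, transl (s / N) ∈ S)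

include hJ in
theorem RowMem.of_gcd_left {a b c d : ℤ} (h : RowMem N S 0 b (Int.gcd a c) d) :
    RowMem N S a b c d := by
  obtain ⟨g, h1, h2⟩ := exists_sl_row_eq a c
  refine RowMem.of_mul (hJ _ (sl13_mem g)) (sl13_isRep N g) ?_
  convert h using 1 <;> simp [sl13, h1, h2]

include hJ in
theorem RowMem.of_swap {a b c d : ℤ} (h : RowMem N S c b (-a) d) : RowMem N S a b c d := by
  refine RowMem.of_mul (hJ _ (sl13_mem ⟨!![0, -1; 1, 0], by simp⟩)) (sl13_isRep N _) ?_
  convert h using 1 <;> simp [sl13]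

include hJ hμ in
theorem RowMem.of_gcd_right {a b c d : ℤ} (h : RowMem N S a 0 c (Int.gcd b d)) :
    RowMem N S a b c d := by
  obtain ⟨g, h1, h2⟩ := exists_sl_row_eq b d
  refine RowMem.of_mul (hμ _ (hJ _ (sl13_mem g))) (sl24_isRep hN g) ?_
  convert h using 1 <;> simp [sl24, h1, h2]

include hJ hμ in
-- This move mixes the pairs `(a, c)` and `(b, d)`, which the two copies of `SL₂(ℤ)` keep apart.
theorem RowMem.of_heis (l : ℤ) {a b c d : ℤ} (h : RowMem N S a (b - N * l * a) (c + l * d) d) :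
    RowMem N S a b c d := by
  refine RowMem.of_mul (hμ _ (hJ _ (heis_mem l))) (heisConj_isRep hN l) ?_
  convert h using 1 <;> simp [heisConj] <;> ring

include hN in
theorem IsRep.blocks {σ : symplecticGroup (Fin 2) ℝ} {Z : Matrix Idx Idx ℤ} (h : IsRep N σ Z) :
    σ.1 = fromBlocks
      !![(Z.toBlocks₁₁ 0 0 : ℝ), Z.toBlocks₁₁ 0 1; Z.toBlocks₁₁ 1 0, Z.toBlocks₁₁ 1 1]
      !![(Z.toBlocks₁₂ 0 0 : ℝ), Z.toBlocks₁₂ 0 1 / N; Z.toBlocks₁₂ 1 0, Z.toBlocks₁₂ 1 1 / N]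
      !![(Z.toBlocks₂₁ 0 0 : ℝ), Z.toBlocks₂₁ 0 1; N * Z.toBlocks₂₁ 1 0, N * Z.toBlocks₂₁ 1 1]
      !![(Z.toBlocks₂₂ 0 0 : ℝ), Z.toBlocks₂₂ 0 1 / N; N * Z.toBlocks₂₂ 1 0, Z.toBlocks₂₂ 1 1] := by
  have h1 : (N : ℝ) ≠ 0 := by exact_mod_cast hN.ne'
  have h2 (i j) := congrFun (congrFun h.eq i) j
  simp only [scaling, Matrix.mul_apply, Fintype.sum_sum_type, Fin.sum_univ_two] at h2
  ext i j
  have h3 := h2 i j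
  rcases i with i | i <;> rcases j with j | j <;> fin_cases i <;> fin_cases j <;>
    simp [toBlocks₁₁, toBlocks₁₂, toBlocks₂₁, toBlocks₂₂] at h3 ⊢ <;>
    first | exact h3 | (field_simp; linarith) | exact mul_right_cancel₀ h1 (h3.trans (mul_comm _ _))

theorem symplectic_rows {σ : Matrix Idx Idx ℝ} (h : σ ∈ symplecticGroup (Fin 2) ℝ) (i j : Idx) :
    σ i (Sum.inr 0) * σ j (Sum.inl 0) + σ i (Sum.inr 1) * σ j (Sum.inl 1) -
      (σ i (Sum.inl 0) * σ j (Sum.inr 0) + σ i (Sum.inl 1) * σ j (Sum.inr 1)) =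
      J (Fin 2) ℝ i j := by
  rw [← SymplecticGroup.mem_iff.1 h]
  simp [Matrix.mul_apply, J, Matrix.one_apply]
  ring

include hN hJ hT in
-- The symplectic relations with the last row `(0, 0, 0, 1)` force the second column to be `(0, 1,
-- 0, 0)`. The one entry that may have denominator `N` is then removed by a translation, leaving an
-- integral Jacobi matrix.
theorem rowMem_base : RowMem N S 0 0 0 1 := by
  intro σ Z hZ h1 h2 h3 h4
  have hN0 : (N : ℝ) ≠ 0 := by exact_mod_cast hN.ne'
  have hσ := hZ.blocks hN
  have r1 := symplectic_rows σ.2 (Sum.inl 0) (Sum.inr 1)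
  have r2 := symplectic_rows σ.2 (Sum.inl 1) (Sum.inr 1)
  have r3 := symplectic_rows σ.2 (Sum.inr 0) (Sum.inr 1)
  rw [hσ] at r1 r2 r3
  simp [h1, h2, h3, h4, J] at r1 r2 r3
  obtain ⟨x, hx⟩ := hZ.dvd₁₂
  obtain ⟨y, hy⟩ := hZ.dvd₂₂
  rw [h1, h2, h3, h4, r1, r2, r3, hx, hy] at hσ
  set γ : Matrix Idx Idx ℤ := fromBlocks
    !![Z.toBlocks₁₁ 0 0, 0; Z.toBlocks₁₁ 1 0, 1] !![Z.toBlocks₁₂ 0 0, x; Z.toBlocks₁₂ 1 0, 0]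
    !![Z.toBlocks₂₁ 0 0, 0; 0, 0] !![Z.toBlocks₂₂ 0 0, y; 0, 1] with hγ
  set τ := transl ((Z.toBlocks₁₂ 1 1 : ℤ) / N) with hτ
  have hmul : γ.map (fun x : ℤ => (x : ℝ)) * τ.1 = σ.1 := by
    rw [hσ, hγ, hτ, transl, fromBlocks_map, fromBlocks_multiply, fromBlocks_inj]
    refine ⟨?_, ?_, ?_, ?_⟩ <;> ext i j <;> fin_cases i <;> fin_cases j <;>
      simp [map_fin_two, hN0]
  have hγσ : γ.map (fun x : ℤ => (x : ℝ)) = (σ * τ⁻¹).1 := by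
    change _ = σ.1 * (τ⁻¹).1
    have : τ.1 * (τ⁻¹).1 = 1 := congrArg Subtype.val (mul_inv_cancel τ)
    rw [← hmul, Matrix.mul_assoc, this, Matrix.mul_one]
  have hsp : γ ∈ symplecticGroup (Fin 2) ℤ := by
    have h5 := (σ * τ⁻¹).2
    rw [← hγσ, SymplecticGroup.mem_iff] at h5
    rw [SymplecticGroup.mem_iff]
    apply Matrix.map_injective (Int.cast_injective (α := ℝ))
    change (γ * J (Fin 2) ℤ * γᵀ).map (Int.castRingHom ℝ) = (J (Fin 2) ℤ).map (Int.castRingHom ℝ)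
    rw [Matrix.map_mul, Matrix.map_mul, map_J]
    exact h5
  have hγJ : γ ∈ jacobiGroup := by
    refine ⟨hsp, !![Z.toBlocks₁₁ 0 0, 0; Z.toBlocks₁₁ 1 0, 1],
      !![Z.toBlocks₁₂ 0 0, x; Z.toBlocks₁₂ 1 0, 0], !![Z.toBlocks₂₁ 0 0, 0; 0, 0],
      !![Z.toBlocks₂₂ 0 0, y; 0, 1], ?_⟩
    simp [hγ]
  have hmem : σ * τ⁻¹ ∈ S := by
    have h7 : jacobiSp γ hγJ = σ * τ⁻¹ := Subtype.ext hγσ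
    exact h7 ▸ hJ γ hγJ
  exact (Subgroup.mul_mem_cancel_right S (inv_mem (hT _))).1 hmem

include hN hJ hμ hT in
theorem rowMem (a b c d : ℤ) : RowMem N S a b c d := by
  refine RowMem.of_gcd_left hJ (RowMem.of_gcd_right hN hJ hμ ?_)
  set g : ℤ := (Int.gcd a c : ℤ)
  set h : ℤ := (Int.gcd b d : ℤ)
  intro σ Z hZ h1 h2 h3 h4
  have r2 := symplectic_rows σ.2 (Sum.inl 1) (Sum.inr 1)
  rw [hZ.blocks hN] at r2
  simp [h1, h2, h3, h4, J] at r2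
  -- The last row is now `(0, 0, g, h)`. Pairing it with the second row shows that `N * g` and `h`
  -- are coprime.
  have r2' : Z.toBlocks₁₁ 1 0 * (N * g) + Z.toBlocks₁₁ 1 1 * h = 1 := by
    have : ((Z.toBlocks₁₁ 1 0 * (N * g) + Z.toBlocks₁₁ 1 1 * h : ℤ) : ℝ) = (1 : ℤ) := by
      push_cast
      linarith
    exact_mod_cast this
  have hgh : Int.gcd g h = 1 :=
    Int.isCoprime_iff_gcd_eq_one.1 ⟨Z.toBlocks₁₁ 1 0 * N, Z.toBlocks₁₁ 1 1, by linarith⟩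
  have hgh' : Int.gcd (-(N * g)) h = 1 :=
    Int.isCoprime_iff_gcd_eq_one.1 ⟨-Z.toBlocks₁₁ 1 0, Z.toBlocks₁₁ 1 1, by linarith⟩
  -- The row runs through `(g, 0, 0, h)`, `(g, -Ng, h, h)`, `(g, 0, h, 1)`, `(0, 0, 1, 1)`, `(0, 0,
  -- 0, 1)`; coprimality makes both gcds equal to `1`.
  refine RowMem.of_swap hJ (RowMem.of_heis hN hJ hμ 1 (RowMem.of_gcd_right hN hJ hμ
    (RowMem.of_gcd_left hJ (RowMem.of_heis hN hJ hμ (-1) ?_)))) σ Z hZ h1 h2 h3 h4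
  have e1 : Int.gcd (0 - N * 1 * g) h = 1 := by rw [← hgh']; congr 1; ring
  have e2 : Int.gcd g (-0 + 1 * h) = 1 := by rw [← hgh]; congr 1; ring
  rw [e1, e2]
  simpa using rowMem_base hN hJ hT

include hJ hμ hT in
/-- A subgroup that contains the Jacobi group and the translations by `1/N`, and is normalised by
`μ_N`, contains the paramodular group. -/
theorem mem_of_mem_paramodularGroup {σ : symplecticGroup (Fin 2) ℝ} {q : Matrix Idx Idx ℚ}
    (hq : q ∈ paramodularGroup N) (hσ : σ.1 = q.map (fun x : ℚ => (x : ℝ))) : σ ∈ S := by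
  obtain ⟨-, a, b, c, d, rfl⟩ := hq
  have hN0 : (N : ℝ) ≠ 0 := by exact_mod_cast hN.ne'
  refine rowMem hN hJ hμ hT _ _ _ _ σ (fromBlocks
    !![a 0 0, N * a 0 1; a 1 0, a 1 1] !![b 0 0, N * b 0 1; b 1 0, b 1 1]
    !![c 0 0, N * c 0 1; c 1 0, c 1 1] !![d 0 0, N * d 0 1; d 1 0, d 1 1])
    ⟨?_, ?_, ?_, ?_, ?_⟩ rfl rfl rfl rfl
  · rw [hσ]
    simp only [scaling, fromBlocks_map, map_fin_two, fromBlocks_multiply, Matrix.mul_zero,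
      Matrix.zero_mul, Matrix.one_mul, Matrix.mul_one, add_zero, zero_add, mul_fin_two,
      fromBlocks_inj]
    refine ⟨?_, ?_, ?_, ?_⟩ <;> ext i j <;> fin_cases i <;> fin_cases j <;>
      (simp [mul_comm]; try field_simp)
  all_goals simp

end Generation

/-! ### Fourier coefficients of absolutely convergent exponential series. -/

theorem e_add (z w : ℂ) : e (z + w) = e z * e w := by
  rw [e, e, e, ← Complex.exp_add, mul_add]

theorem norm_e (z : ℂ) : ‖e z‖ = Real.exp (-(2 * Real.pi * z.im)) := by
  rw [e, Complex.norm_exp]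
  simp [Complex.mul_re]

theorem norm_e_ofReal (x : ℝ) : ‖e x‖ = 1 := by
  simp [norm_e]

theorem e_int (n : ℤ) : e n = 1 :=
  Complex.exp_eq_one_iff.2 ⟨n, by ring⟩

theorem differentiable_e : Differentiable ℂ e :=
  (differentiable_id.const_mul (2 * Real.pi * Complex.I)).cexp

theorem hasDerivAt_e (z : ℂ) : HasDerivAt e (e z * (2 * Real.pi * Complex.I)) z := by
  have h := ((hasDerivAt_id' z).const_mul (2 * Real.pi * Complex.I : ℂ)).cexp
  rw [mul_one] at h
  exact h

theorem integral_e_int_mul (n : ℤ) :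
    ∫ x in (0 : ℝ)..1, e (n * x) = if n = 0 then 1 else 0 := by
  split_ifs with h
  · simp [h, e]
  · have hc : 2 * Real.pi * Complex.I * n ≠ 0 :=
      mul_ne_zero Complex.two_pi_I_ne_zero (by exact_mod_cast h)
    have h1 := integral_exp_mul_complex (a := 0) (b := 1) hc
    have h2 : Complex.exp (2 * Real.pi * Complex.I * n) = 1 := e_int n
    simp only [Complex.ofReal_one, mul_one, h2, Complex.ofReal_zero, mul_zero, Complex.exp_zero,
      sub_self, zero_div] at h1
    simpa only [e, mul_assoc] using h1

/-- A bound for an absolutely convergent trigonometric series bounds its Fourier coefficients. -/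
theorem norm_tsum_ite_le {ι : Type*} [Countable ι] {a : ι → ℂ} (ha : Summable fun i => ‖a i‖)
    (k : ι → ℤ) {B : ℝ} (hB : ∀ x ∈ Set.Icc (0 : ℝ) 1, ‖∑' i, a i * e (k i * x)‖ ≤ B) (K : ℤ) :
    ‖∑' i, if k i = K then a i else 0‖ ≤ B := by
  have hce : Continuous e := differentiable_e.continuous
  -- Integrating against `e(-Kx)` keeps exactly the terms of frequency `K`; absolute convergence
  -- supplies the dominating series.
  have h := intervalIntegral.hasSum_integral_of_dominated_convergence (μ := MeasureTheory.volume)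
    (a := 0) (b := 1) (F := fun i (x : ℝ) => a i * e ((k i - K : ℤ) * x))
    (f := fun x : ℝ => (∑' i, a i * e (k i * x)) * e (((-(K * x) : ℝ)) : ℂ))
    (fun i _ => ‖a i‖) (fun i => by fun_prop)
    (fun i => Filter.Eventually.of_forall fun x _ => by
      rw [norm_mul]
      have := norm_e_ofReal ((k i - K : ℤ) * x)
      push_cast at this ⊢
      rw [this, mul_one])
    (Filter.Eventually.of_forall fun x _ => ha) (by simp)
    (Filter.Eventually.of_forall fun x _ => by
      have hs : Summable fun i => a i * e (k i * x) := by
        refine Summable.of_norm (ha.congr fun i => ?_)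
        have := norm_e_ofReal (k i * x)
        push_cast at this
        rw [norm_mul, this, mul_one]
      refine (hs.hasSum.mul_right _).congr_fun fun i => ?_
      rw [mul_assoc, ← e_add]
      congr 2
      push_cast
      ring)
  simp only [intervalIntegral.integral_const_mul, integral_e_int_mul, sub_eq_zero, mul_ite,
    mul_one, mul_zero] at h
  rw [h.tsum_eq]
  refine (intervalIntegral.norm_integral_le_of_norm_le_const (C := B) fun x hx => ?_).trans
    (by simp)
  rw [Set.uIoc_of_le zero_le_one] at hx
  rw [norm_mul, norm_e_ofReal, mul_one]
  exact hB x ⟨hx.1.le, hx.2⟩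

theorem summable_norm_mul_e {ι : Type*} {a : ι → ℂ} (ha : Summable fun i => ‖a i‖)
    (x : ι → ℝ) : Summable fun i => ‖a i * e (x i)‖ := by
  simpa only [norm_mul, norm_e_ofReal, mul_one] using ha

/-- The three frequencies are isolated one variable at a time, and injectivity leaves only the term
`j`. Taking `B = 0` gives uniqueness of coefficients; zero frequencies give the versions in fewer
variables. -/
theorem norm_coeff_le {ι : Type*} [Countable ι] {a : ι → ℂ} (ha : Summable fun i => ‖a i‖)
    (k₁ k₂ k₃ : ι → ℤ) (hk : ∀ i j, k₁ i = k₁ j → k₂ i = k₂ j → k₃ i = k₃ j → i = j) {B : ℝ}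
    (hB : ∀ x ∈ Set.Icc (0 : ℝ) 1, ∀ y ∈ Set.Icc (0 : ℝ) 1, ∀ w ∈ Set.Icc (0 : ℝ) 1,
      ‖∑' i, a i * e (k₁ i * x + k₂ i * y + k₃ i * w)‖ ≤ B) (j : ι) : ‖a j‖ ≤ B := by
  have hite {b : ι → ℂ} (hb : Summable fun i => ‖b i‖) (k : ι → ℤ) (K : ℤ) :
      Summable fun i => ‖if k i = K then b i else 0‖ := by
    refine Summable.of_nonneg_of_le (fun _ => norm_nonneg _) (fun i => ?_) hb
    split_ifs <;> simp
  have h1 : ∀ y ∈ Set.Icc (0 : ℝ) 1, ∀ w ∈ Set.Icc (0 : ℝ) 1,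
      ‖∑' i, (if k₁ i = k₁ j then a i else 0) * e (k₂ i * y + k₃ i * w)‖ ≤ B := by
    intro y hy w hw
    have hs := summable_norm_mul_e ha (fun i => k₂ i * y + k₃ i * w)
    have := norm_tsum_ite_le hs k₁ (B := B) (fun x hx => ?_) (k₁ j)
    · convert this using 2
      refine tsum_congr fun i => ?_
      push_cast
      split_ifs <;> simp
    · convert hB x hx y hy w hw using 2
      refine tsum_congr fun i => ?_
      rw [mul_assoc, ← e_add]
      push_cast
      congr 2
      ring
  have ha1 := hite ha k₁ (k₁ j)
  have h2 : ∀ w ∈ Set.Icc (0 : ℝ) 1,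
      ‖∑' i, (if k₂ i = k₂ j then (if k₁ i = k₁ j then a i else 0) else 0) * e (k₃ i * w)‖ ≤ B := by
    intro w hw
    have hs := summable_norm_mul_e ha1 (fun i => k₃ i * w)
    have := norm_tsum_ite_le hs k₂ (B := B) (fun y hy => ?_) (k₂ j)
    · convert this using 2
      refine tsum_congr fun i => ?_
      push_cast
      split_ifs <;> simp
    · convert h1 y hy w hw using 2
      refine tsum_congr fun i => ?_
      rw [mul_assoc, ← e_add]
      push_cast
      congr 2
      ring
  have h3 := norm_tsum_ite_le (hite ha1 k₂ (k₂ j)) k₃ h2 (k₃ j)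
  rw [tsum_eq_single j] at h3
  · simpa using h3
  · intro i hi
    split_ifs with e3 e2 e1
    · exact absurd (hk i j e1 e2 e3) hi
    all_goals rfl

/-! ### Semidefinite indices and convergence of the Fourier series. -/

theorem posSemidef_fin_two_iff {a b d : ℝ} (ha : 0 ≤ a) (hd : 0 ≤ d) :
    (!![a, b; b, d]).PosSemidef ↔ b ^ 2 ≤ a * d := by
  constructor
  · intro h
    have := h.det_nonneg
    rw [det_fin_two_of] at this
    linarith
  · intro h
    refine PosSemidef.of_dotProduct_mulVec_nonneg ?_ fun x => ?_
    · ext i j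
      fin_cases i <;> fin_cases j <;> simp
    · have hx : |2 * b * x 0 * x 1| ≤ a * x 0 ^ 2 + d * x 1 ^ 2 := by
        apply abs_le_of_sq_le_sq _ (by positivity)
        have h1 : b ^ 2 * (x 0 ^ 2 * x 1 ^ 2) ≤ a * d * (x 0 ^ 2 * x 1 ^ 2) := by gcongr
        nlinarith [sq_nonneg (a * x 0 ^ 2 - d * x 1 ^ 2)]
      have := neg_abs_le (2 * b * x 0 * x 1)
      simp [dotProduct, mulVec, Fin.sum_univ_two]
      nlinarith

theorem isSemiIndex_iff {N n m : ℕ} {r : ℤ} :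
    IsSemiIndex N n r m ↔ r ^ 2 ≤ 4 * (m : ℤ) * n ∧ N ∣ m := by
  rw [IsSemiIndex, posSemidef_fin_two_iff (by positivity) (by positivity)]
  have : ((r : ℝ) / 2) ^ 2 ≤ n * m ↔ r ^ 2 ≤ 4 * (m : ℤ) * n := by
    rw [← Int.cast_le (R := ℝ)]
    push_cast
    constructor <;> intro h <;> linarith
  rw [this]

/-- The exponents of a Fourier–Jacobi series supported on multiples of `N`: the triple `(l, n, r)`
stands for the matrix `(n, r/2; r/2, lN)`. -/
abbrev Exponent : Type := ℕ × ℕ × ℤ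

/-- The linear form `nτ + rz + lNω`. -/
def phase (N : ℕ) (t : Exponent) : ℂ × ℂ × ℂ →L[ℂ] ℂ :=
  (t.2.1 : ℂ) • ContinuousLinearMap.fst ℂ ℂ (ℂ × ℂ) +
    (t.2.2 : ℂ) • (ContinuousLinearMap.fst ℂ ℂ ℂ ∘L ContinuousLinearMap.snd ℂ ℂ (ℂ × ℂ)) +
    ((t.1 * N : ℕ) : ℂ) • (ContinuousLinearMap.snd ℂ ℂ ℂ ∘L ContinuousLinearMap.snd ℂ ℂ (ℂ × ℂ))

theorem phase_apply (N : ℕ) (t : Exponent) (p : ℂ × ℂ × ℂ) :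
    phase N t p = t.2.1 * p.1 + t.2.2 * p.2.1 + (t.1 * N : ℕ) * p.2.2 := by
  simp [phase]

/-- The Fourier coefficient of the formal series at a given exponent. -/
def coeff (N : ℕ) (φ : ℕ → ℂ × ℂ → ℂ) (t : Exponent) : ℂ :=
  if t.2.2 ^ 2 ≤ 4 * ((t.1 * N : ℕ) : ℤ) * t.2.1 then jacobiCoeff (φ (t.1 * N)) t.2.1 t.2.2 else 0

/-- The term of the Fourier series at a given exponent. -/
def fourierTerm (N : ℕ) (φ : ℕ → ℂ × ℂ → ℂ) (t : Exponent) (p : ℂ × ℂ × ℂ) : ℂ :=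
  coeff N φ t * e (phase N t p)

/-- The points whose imaginary part exceeds `δ` times the identity. -/
def shiftedCone (δ : ℝ) : Set (ℂ × ℂ × ℂ) :=
  {p | δ < p.1.im ∧ p.2.1.im ^ 2 < (p.1.im - δ) * (p.2.2.im - δ)}

theorem isOpen_shiftedCone (δ : ℝ) : IsOpen (shiftedCone δ) :=
  IsOpen.inter (s := {p : ℂ × ℂ × ℂ | δ < p.1.im})
    (t := {p : ℂ × ℂ × ℂ | p.2.1.im ^ 2 < (p.1.im - δ) * (p.2.2.im - δ)})
    (isOpen_lt (by fun_prop) (by fun_prop)) (isOpen_lt (by fun_prop) (by fun_prop))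

theorem exists_mem_shiftedCone {p : ℂ × ℂ × ℂ} (hp : symMat p ∈ siegelH2) :
    ∃ δ > 0, p ∈ shiftedCone δ := by
  obtain ⟨h1, h2⟩ := (symMat_mem_iff p).1 hp
  have h3 : 0 < p.2.2.im := pos_of_mul_pos_right ((sq_nonneg _).trans_lt h2) h1.le
  set D := p.1.im * p.2.2.im - p.2.1.im ^ 2 with hD
  have hD0 : 0 < D := sub_pos.2 h2
  -- For `Y = Im Ω` and `δ = det Y / (2 tr Y)`, one has `det(Y - δ) = det Y / 2 + δ² > 0`.
  refine ⟨D / (2 * (p.1.im + p.2.2.im)), by positivity, ?_, ?_⟩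
  · rw [div_lt_iff₀ (by positivity)]
    nlinarith [sq_nonneg p.2.1.im]
  · have : D / (2 * (p.1.im + p.2.2.im)) * (p.1.im + p.2.2.im) = D / 2 := by
      field_simp
    nlinarith [sq_nonneg (D / (2 * (p.1.im + p.2.2.im)))]

/-- This is `tr(TY) ≥ δ tr T` for semidefinite `T` and `Y > δ`: the discriminant bounds and the
inequality of the means control the mixed term of `tr(T(Y - δ))`. -/
theorem le_im_phase {N : ℕ} {t : Exponent} (ht : t.2.2 ^ 2 ≤ 4 * ((t.1 * N : ℕ) : ℤ) * t.2.1)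
    {δ : ℝ} {p : ℂ × ℂ × ℂ} (hp : p ∈ shiftedCone δ) :
    δ * (t.2.1 + (t.1 * N : ℕ)) ≤ (phase N t p).im := by
  obtain ⟨h1, h2⟩ := hp
  have h3 : 0 < p.2.2.im - δ :=
    pos_of_mul_pos_right ((sq_nonneg _).trans_lt h2) (sub_nonneg.2 h1.le)
  have h4 := sub_pos.2 h1
  have ht' : (t.2.2 : ℝ) ^ 2 ≤ 4 * (t.1 * N : ℕ) * t.2.1 := by exact_mod_cast ht
  have hi : (phase N t p).im =
      t.2.1 * p.1.im + t.2.2 * p.2.1.im + (t.1 * N : ℕ) * p.2.2.im := by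
    rw [phase_apply]
    simp
  rw [hi]
  have hn : (0 : ℝ) ≤ t.2.1 := by positivity
  have hm : (0 : ℝ) ≤ (t.1 * N : ℕ) := by positivity
  set a := p.1.im - δ
  set c := p.2.2.im - δ
  have h5 : |t.2.2 * p.2.1.im| ≤ t.2.1 * a + (t.1 * N : ℕ) * c := by
    apply abs_le_of_sq_le_sq _ (by positivity)
    have h6 : (t.2.2 : ℝ) ^ 2 * p.2.1.im ^ 2 ≤ 4 * (t.1 * N : ℕ) * t.2.1 * (a * c) := by gcongr
    nlinarith [sq_nonneg (t.2.1 * a - (t.1 * N : ℕ) * c)]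
  have h7 := neg_abs_le (t.2.2 * p.2.1.im)
  have ha : p.1.im = a + δ := by ring
  have hc : p.2.2.im = c + δ := by ring
  rw [ha, hc]
  linarith

theorem abs_le_of_sq_le {n m : ℕ} {r : ℤ} (h : r ^ 2 ≤ 4 * (m : ℤ) * n) :
    |(r : ℝ)| ≤ n + m := by
  have h' : (r : ℝ) ^ 2 ≤ 4 * m * n := by exact_mod_cast h
  apply abs_le_of_sq_le_sq _ (by positivity)
  nlinarith [sq_nonneg ((n : ℝ) - m)]

theorem summable_exponent_geometric {q : ℝ} (h0 : 0 ≤ q) (h1 : q < 1) :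
    Summable fun t : Exponent => q ^ t.1 * (q ^ t.2.1 * q ^ t.2.2.natAbs) := by
  have hs := summable_geometric_of_lt_one h0 h1
  have hz : Summable fun r : ℤ => q ^ r.natAbs := by
    rw [summable_int_iff_summable_nat_and_neg]
    simpa using hs
  exact hs.mul_of_nonneg (hs.mul_of_nonneg hz (fun n => by positivity) (fun n => by positivity))
    (fun n => by positivity) (fun n => by positivity)

theorem norm_coeff_le_of_growth {N : ℕ} {φ : ℕ → ℂ × ℂ → ℂ} {A ρ : ℝ} (hA : 0 ≤ A) (hρ : 0 ≤ ρ)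
    (h : ∀ (n : ℕ) (r : ℤ) (m : ℕ), IsSemiIndex N n r m →
      ‖jacobiCoeff (φ m) n r‖ ≤ A * ρ ^ (n + m)) (t : Exponent) :
    ‖coeff N φ t‖ ≤ A * ρ ^ (t.2.1 + t.1 * N) := by
  rw [coeff]
  split_ifs with ht
  · exact h _ _ _ (isSemiIndex_iff.2 ⟨ht, dvd_mul_left _ _⟩)
  · rw [norm_zero]; positivity

/-- Under the growth condition, the Fourier series and its termwise derivative are dominated by
a summable family on every shifted cone. -/
theorem exists_summable_bound {N : ℕ} (hN : 0 < N) {φ : ℕ → ℂ × ℂ → ℂ} (hφ : GrowthCondition N φ)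
    {δ : ℝ} (hδ : 0 < δ) : ∃ u : Exponent → ℝ, Summable u ∧ ∀ t, ∀ p ∈ shiftedCone δ,
      ‖fourierTerm N φ t p‖ * (1 + 2 * Real.pi * (t.2.1 + |(t.2.2 : ℝ)| + (t.1 * N : ℕ))) ≤
        u t := by
  have hπ := Real.pi_pos
  -- With `s = n + m`, the exponential decays like `exp(-2πδs)`. The coefficient and the derivative
  -- factor each cost `exp(πδs/2)`, so `exp(-πδs)` remains.
  obtain ⟨A, hA, hgrow⟩ := hφ (Real.exp (Real.pi * δ / 2)) (Real.one_lt_exp_iff.2 (by positivity))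
  set q := Real.exp (-(Real.pi * δ / 2)) with hq
  have hq1 : q < 1 := Real.exp_lt_one_iff.2 (by linarith [show 0 < Real.pi * δ / 2 by positivity])
  refine ⟨fun t => A * (1 + 8 / δ) * (q ^ t.1 * (q ^ t.2.1 * q ^ t.2.2.natAbs)),
    (summable_exponent_geometric (Real.exp_pos _).le hq1).mul_left _, fun t p hp => ?_⟩
  by_cases ht : t.2.2 ^ 2 ≤ 4 * ((t.1 * N : ℕ) : ℤ) * t.2.1
  swap
  · have : coeff N φ t = 0 := if_neg ht
    rw [fourierTerm, this, zero_mul, norm_zero, zero_mul]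
    positivity
  have hr := abs_le_of_sq_le ht
  have him := le_im_phase ht hp
  have hc := norm_coeff_le_of_growth hA.le (Real.exp_pos _).le hgrow t
  rw [← Real.exp_nat_mul] at hc
  push_cast at hr him hc ⊢
  set s : ℝ := t.2.1 + t.1 * N with hs
  have hs0 : 0 ≤ s := by positivity
  have hb1 : ‖fourierTerm N φ t p‖ ≤
      A * Real.exp (s * (Real.pi * δ / 2)) * Real.exp (-(2 * Real.pi * (δ * s))) := by
    rw [fourierTerm, norm_mul, norm_e]
    gcongr
  have hb2 : 1 + 2 * Real.pi * (t.2.1 + |(t.2.2 : ℝ)| + t.1 * N) ≤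
      (1 + 8 / δ) * Real.exp (s * (Real.pi * δ / 2)) := by
    have h1 : 2 * Real.pi * (t.2.1 + |(t.2.2 : ℝ)| + t.1 * N) ≤ 8 / δ * (s * (Real.pi * δ / 2)) := by
      have : 8 / δ * (s * (Real.pi * δ / 2)) = 2 * Real.pi * (2 * s) := by field_simp; ring
      rw [this]
      gcongr
      linarith
    have h2 := Real.add_one_le_exp (s * (Real.pi * δ / 2))
    have h3 : 1 ≤ Real.exp (s * (Real.pi * δ / 2)) := Real.one_le_exp (by positivity)
    have h4 : 8 / δ * (s * (Real.pi * δ / 2)) ≤ 8 / δ * Real.exp (s * (Real.pi * δ / 2)) := by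
      gcongr
      linarith
    linarith
  -- Since `|r| ≤ s` and `l ≤ lN`, the sum `l + n + |r|` is at most `2s`, so the remaining decay
  -- bounds a product of three geometric terms.
  have hb3 : Real.exp (-(Real.pi * δ * s)) ≤ q ^ t.1 * (q ^ t.2.1 * q ^ t.2.2.natAbs) := by
    rw [← pow_add, ← pow_add, hq, ← Real.exp_nat_mul]
    apply Real.exp_le_exp.2
    have h1 : (t.1 : ℝ) ≤ t.1 * N := by
      have : (1 : ℝ) ≤ N := by exact_mod_cast hN
      nlinarith [show (0 : ℝ) ≤ t.1 by positivity]
    have h2 : ((t.2.2.natAbs : ℕ) : ℝ) = |(t.2.2 : ℝ)| := by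
      rw [Nat.cast_natAbs, Int.cast_abs]
    push_cast
    rw [h2]
    have h3 : (t.1 : ℝ) + (t.2.1 + |(t.2.2 : ℝ)|) ≤ 2 * s := by linarith
    have := mul_le_mul_of_nonneg_right h3 (show 0 ≤ Real.pi * δ / 2 by positivity)
    linarith
  calc _ ≤ A * Real.exp (s * (Real.pi * δ / 2)) * Real.exp (-(2 * Real.pi * (δ * s))) *
        ((1 + 8 / δ) * Real.exp (s * (Real.pi * δ / 2))) := by gcongr
    _ = A * (1 + 8 / δ) * Real.exp (s * (Real.pi * δ / 2) + -(2 * Real.pi * (δ * s)) +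
        s * (Real.pi * δ / 2)) := by rw [Real.exp_add, Real.exp_add]; ring
    _ = A * (1 + 8 / δ) * Real.exp (-(Real.pi * δ * s)) := by congr 2; ring
    _ ≤ _ := by gcongr

theorem summable_norm_fourierTerm {N : ℕ} (hN : 0 < N) {φ : ℕ → ℂ × ℂ → ℂ}
    (hφ : GrowthCondition N φ) {p : ℂ × ℂ × ℂ} (hp : symMat p ∈ siegelH2) :
    Summable fun t => ‖fourierTerm N φ t p‖ := by
  obtain ⟨δ, hδ, hpδ⟩ := exists_mem_shiftedCone hp
  obtain ⟨u, hu, h⟩ := exists_summable_bound hN hφ hδ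
  refine Summable.of_nonneg_of_le (fun _ => norm_nonneg _) (fun t => le_trans ?_ (h t p hpδ)) hu
  refine le_mul_of_one_le_right (norm_nonneg _) ?_
  have : 0 ≤ 2 * Real.pi * (t.2.1 + |(t.2.2 : ℝ)| + (t.1 * N : ℕ)) := by positivity
  linarith

theorem norm_phase_le (N : ℕ) (t : Exponent) :
    ‖phase N t‖ ≤ t.2.1 + |(t.2.2 : ℝ)| + (t.1 * N : ℕ) := by
  refine ContinuousLinearMap.opNorm_le_bound _ (by positivity) fun p => ?_
  rw [phase_apply, add_mul, add_mul]
  have h1 : ‖p.1‖ ≤ ‖p‖ := norm_fst_le p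
  have h2 : ‖p.2.1‖ ≤ ‖p‖ := (norm_fst_le p.2).trans (norm_snd_le p)
  have h3 : ‖p.2.2‖ ≤ ‖p‖ := (norm_snd_le p.2).trans (norm_snd_le p)
  refine (norm_add₃_le).trans ?_
  simp only [norm_mul, Complex.norm_natCast, Complex.norm_intCast]
  gcongr

theorem differentiableOn_tsum_fourierTerm {N : ℕ} (hN : 0 < N) {φ : ℕ → ℂ × ℂ → ℂ}
    (hφ : GrowthCondition N φ) :
    DifferentiableOn ℂ (fun p => ∑' t, fourierTerm N φ t p) {p | symMat p ∈ siegelH2} := by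
  intro p hp
  obtain ⟨δ, hδ, hpδ⟩ := exists_mem_shiftedCone hp
  obtain ⟨u, hu, h⟩ := exists_summable_bound hN hφ hδ
  obtain ⟨r, hr, hball⟩ := Metric.isOpen_iff.1 (isOpen_shiftedCone δ) p hpδ
  have hterm (t : Exponent) (x : ℂ × ℂ × ℂ) : HasFDerivAt (fourierTerm N φ t)
      (coeff N φ t • ((e (phase N t x) * (2 * Real.pi * Complex.I)) • phase N t)) x :=
    ((hasDerivAt_e _).comp_hasFDerivAt x (phase N t).hasFDerivAt).const_mul _
  -- On a ball inside a shifted cone the same `u` dominates all the derivatives, so the series may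
  -- be differentiated termwise.
  have hd := hasFDerivAt_tsum_of_isPreconnected hu Metric.isOpen_ball
    (convex_ball p r).isPreconnected (fun t x _ => hterm t x) (fun t x hx => ?_)
    (Metric.mem_ball_self hr) (summable_norm_fourierTerm hN hφ hp).of_norm
    (Metric.mem_ball_self hr)
  · exact hd.differentiableAt.differentiableWithinAt
  · refine le_trans ?_ (h t x (hball hx))
    have h2 : ‖(2 * Real.pi * Complex.I : ℂ)‖ = 2 * Real.pi := by
      simp [abs_of_pos Real.pi_pos]
    rw [norm_smul, norm_smul, norm_mul, h2, fourierTerm, norm_mul, mul_assoc, mul_assoc, mul_assoc]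
    have := norm_phase_le N t
    gcongr
    have h3 := mul_le_mul_of_nonneg_left this Real.two_pi_pos.le
    linarith

/-! ### Fourier-Jacobi series and the action of `μ_N` on exponents. -/

/-- The Fourier–Jacobi expansion as the iterated sum of the Fourier series. -/
theorem hasSum_fourierJacobi {k : ℤ} {N : ℕ} (hN : 0 < N) {φ : ℕ → ℂ × ℂ → ℂ}
    (hφ : IsFormalJacobiSeries k N φ) (hg : GrowthCondition N φ) {p : ℂ × ℂ × ℂ}
    (hp : symMat p ∈ siegelH2) :
    HasSum (fun l : ℕ => φ (l * N) (p.1, p.2.1) * e ((l * N : ℕ) * p.2.2))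
      (∑' t, fourierTerm N φ t p) := by
  refine (summable_norm_fourierTerm hN hg hp).of_norm.hasSum.prod_fiberwise fun l => ?_
  have h := ((hφ (l * N) (dvd_mul_left _ _)).fourier p.1 p.2.1
    ((symMat_mem_iff p).1 hp).1).mul_right (e ((l * N : ℕ) * p.2.2))
  have h' := (hasSum_subtype_iff_indicator (s := {x : ℕ × ℤ | x.2 ^ 2 ≤ 4 * ((l * N : ℕ) : ℤ) * x.1})
    (f := fun x : ℕ × ℤ => jacobiCoeff (φ (l * N)) x.1 x.2 * e (x.1 * p.1 + x.2 * p.2.1) *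
      e ((l * N : ℕ) * p.2.2))).1 h
  refine h'.congr_fun fun x => ?_
  rw [fourierTerm, coeff, phase_apply, e_add]
  by_cases hx : x.2 ^ 2 ≤ 4 * ((l * N : ℕ) : ℤ) * x.1
  · rw [Set.indicator_of_mem (by exact hx), if_pos hx, mul_assoc]
  · rw [Set.indicator_of_notMem (by exact hx), if_neg hx, zero_mul]

/-- The natural numbers, as the multiples of `N`. -/
def multiplesEquiv {N : ℕ} (hN : 0 < N) : ℕ ≃ {m : ℕ // N ∣ m} where
  toFun l := ⟨l * N, dvd_mul_left _ _⟩
  invFun m := m.1 / N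
  left_inv l := Nat.mul_div_cancel l hN
  right_inv m := Subtype.ext (Nat.div_mul_cancel m.2)

theorem isFourierJacobiExpansion_iff {N : ℕ} (hN : 0 < N) {f : Matrix (Fin 2) (Fin 2) ℂ → ℂ}
    {φ : ℕ → ℂ × ℂ → ℂ} : IsFourierJacobiExpansion N f φ ↔ ∀ p, symMat p ∈ siegelH2 →
      HasSum (fun l : ℕ => φ (l * N) (p.1, p.2.1) * e ((l * N : ℕ) * p.2.2)) (f (symMat p)) := by
  have key (Ω : Matrix (Fin 2) (Fin 2) ℂ) :
      HasSum (fun m : {m : ℕ // N ∣ m} => φ m.1 (Ω 0 0, Ω 0 1) * e ((m.1 : ℂ) * Ω 1 1)) (f Ω) ↔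
        HasSum (fun l : ℕ => φ (l * N) (Ω 0 0, Ω 0 1) * e ((l * N : ℕ) * Ω 1 1)) (f Ω) :=
    ((multiplesEquiv hN).hasSum_iff).symm
  constructor
  · intro h p hp
    exact (key _).1 (h _ hp)
  · intro h Ω hΩ
    have hs := eq_symMat hΩ.1
    rw [key]
    have := h (Ω 0 0, Ω 0 1, Ω 1 1) (by rwa [← hs])
    rwa [← hs] at this

theorem natCast_mul_im (n : ℕ) (z : ℂ) : ((n : ℂ) * z).im = n * z.im := by
  simp

theorem coe_units_int_mul_self (ε : ℤˣ) : (ε : ℤ) * ε = 1 := by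
  rw [← Units.val_mul, Int.units_mul_self, Units.val_one]

/-- The action of `μ_N` in coordinates. -/
def muAct (N : ℕ) (p : ℂ × ℂ × ℂ) : ℂ × ℂ × ℂ := (N * p.2.2, -p.2.1, p.1 / N)

/-- The automorphy factor is `det F_N = 1`, so the weight drops out. -/
theorem slash_mu {N : ℕ} (hN : 0 < N) (k : ℤ) (f : Matrix (Fin 2) (Fin 2) ℂ → ℂ)
    (p : ℂ × ℂ × ℂ) : slash k f (mu N) (symMat p) = f (symMat (muAct N p)) := by
  have hN0 : (N : ℂ) ≠ 0 := by exact_mod_cast hN.ne'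
  have hs : ((Real.sqrt N : ℝ) : ℂ) * (Real.sqrt N : ℝ) = N := by
    rw [← Complex.ofReal_mul, Real.mul_self_sqrt (by positivity)]
    simp
  have hs0 : ((Real.sqrt N : ℝ) : ℂ) ≠ 0 := by
    intro h
    rw [h, mul_zero] at hs
    exact hN0 hs.symm
  have hsq : ((Real.sqrt N : ℝ) : ℂ) ^ 2 = N := by rw [sq, hs]
  set F : Matrix (Fin 2) (Fin 2) ℂ := (fricke N).map Complex.ofReal with hF
  have hFe : F = !![0, 1 / (Real.sqrt N : ℂ); -(N / (Real.sqrt N : ℂ)), 0] := by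
    ext i j
    fin_cases i <;> fin_cases j <;> simp [hF, fricke, div_eq_inv_mul]
  have hd : denom (mu N) (symMat p) = F := by
    simp [denom, mu, hF]
  have hn : numer (mu N) (symMat p) = -Fᵀ * symMat p := by
    ext i j
    simp [numer, mu, hF, Matrix.mul_apply]
  have hdet : F.det = 1 := by
    rw [hFe, det_fin_two_of]
    field_simp
    rw [hsq]; ring
  have hinv : F⁻¹ = -F := by
    apply inv_eq_right_inv
    rw [hFe]
    ext i j
    fin_cases i <;> fin_cases j <;> simp <;> field_simp <;> rw [hsq]
  rw [slash_apply, moebius, hd, hn, hdet, hinv, _root_.one_zpow, one_mul]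
  congr 1
  rw [hFe]
  ext i j
  fin_cases i <;> fin_cases j <;> simp [symMat, muAct, Matrix.mul_apply] <;> field_simp <;>
    rw [hsq] <;> field_simp

theorem muAct_mem {N : ℕ} (hN : 0 < N) {p : ℂ × ℂ × ℂ} (hp : symMat p ∈ siegelH2) :
    symMat (muAct N p) ∈ siegelH2 := by
  have h1 : (0 : ℝ) < N := by exact_mod_cast hN
  obtain ⟨h2, h3⟩ := (symMat_mem_iff p).1 hp
  have h4 : 0 < p.2.2.im := pos_of_mul_pos_right ((sq_nonneg _).trans_lt h3) h2.le
  rw [symMat_mem_iff]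
  simp only [muAct, Complex.neg_im, natCast_mul_im, Complex.div_natCast_im, neg_sq]
  refine ⟨by positivity, ?_⟩
  have : (N : ℝ) * p.2.2.im * (p.1.im / N) = p.1.im * p.2.2.im := by field_simp
  rwa [this]

/-- The involution `(l, n, r) ↦ (n, l, -r)` of the exponents. -/
def swapExponent : Exponent ≃ Exponent where
  toFun t := (t.2.1, t.1, -t.2.2)
  invFun t := (t.2.1, t.1, -t.2.2)
  left_inv t := by simp
  right_inv t := by simp

theorem swapExponent_swapExponent (t : Exponent) : swapExponent (swapExponent t) = t :=
  swapExponent.left_inv t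

theorem phase_muAct {N : ℕ} (hN : 0 < N) (t : Exponent) (p : ℂ × ℂ × ℂ) :
    phase N t (muAct N p) = phase N (swapExponent t) p := by
  have hN0 : (N : ℂ) ≠ 0 := by exact_mod_cast hN.ne'
  rw [phase_apply, phase_apply, muAct, swapExponent]
  simp only [Equiv.coe_fn_mk]
  push_cast
  field_simp
  ring

theorem tsum_fourierTerm_muAct {N : ℕ} (hN : 0 < N) (φ : ℕ → ℂ × ℂ → ℂ) (p : ℂ × ℂ × ℂ) :
    ∑' t, fourierTerm N φ t (muAct N p) = ∑' t, coeff N φ (swapExponent t) * e (phase N t p) := by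
  rw [← swapExponent.tsum_eq]
  refine tsum_congr fun t => ?_
  rw [fourierTerm, phase_muAct hN, swapExponent_swapExponent]

theorem summable_coeff_swap {N : ℕ} (hN : 0 < N) {φ : ℕ → ℂ × ℂ → ℂ} (hφ : GrowthCondition N φ)
    {p : ℂ × ℂ × ℂ} (hp : symMat p ∈ siegelH2) :
    Summable fun t => ‖coeff N φ (swapExponent t) * e (phase N t p)‖ := by
  rw [← swapExponent.summable_iff]
  refine (summable_norm_fourierTerm hN hφ (muAct_mem hN hp)).congr fun t => ?_
  rw [fourierTerm, phase_muAct hN, Function.comp_apply, swapExponent_swapExponent]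

theorem involutionCondition_iff {N : ℕ} (hN : 0 < N) {ε : ℤ} {φ : ℕ → ℂ × ℂ → ℂ} :
    InvolutionCondition N ε φ ↔ ∀ t, coeff N φ t = ε * coeff N φ (swapExponent t) := by
  constructor
  · rintro h ⟨l, n, r⟩
    simp only [coeff, swapExponent, Equiv.coe_fn_mk, neg_sq]
    have hcomm : 4 * ((n * N : ℕ) : ℤ) * l = 4 * ((l * N : ℕ) : ℤ) * n := by push_cast; ring
    rw [hcomm]
    split_ifs with ht
    · have := h n r (l * N) (isSemiIndex_iff.2 ⟨ht, dvd_mul_left _ _⟩)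
      rwa [Nat.mul_div_cancel l hN] at this
    · simp
  · intro h n r m hm
    obtain ⟨ht, l, rfl⟩ := isSemiIndex_iff.1 hm
    rw [mul_comm N l] at ht ⊢
    have := h (l, n, r)
    have hcomm : 4 * ((n * N : ℕ) : ℤ) * l = 4 * ((l * N : ℕ) : ℤ) * n := by push_cast; ring
    simp only [coeff, swapExponent, Equiv.coe_fn_mk, neg_sq, hcomm, if_pos ht] at this
    rwa [Nat.mul_div_cancel l hN]

/-- Uniqueness of the coefficients of a Fourier series on the Siegel upper half space. -/
theorem coeff_eq_zero_of_tsum_eq_zero {N : ℕ} (hN : 0 < N) {d : Exponent → ℂ}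
    (hs : ∀ p, symMat p ∈ siegelH2 → Summable fun t => ‖d t * e (phase N t p)‖)
    (h0 : ∀ p, symMat p ∈ siegelH2 → ∑' t, d t * e (phase N t p) = 0) (t : Exponent) :
    d t = 0 := by
  have hN0 : (N : ℂ) ≠ 0 := by exact_mod_cast hN.ne'
  -- Dividing `w` by `N` turns the frequency `lN` in `ω` into `l`, so the unit cube parametrises a
  -- full period.
  have hmem (x y w : ℝ) : symMat (x + Complex.I, (y : ℂ), w / N + Complex.I) ∈ siegelH2 := by
    rw [symMat_mem_iff]
    have : ((w : ℂ) / N + Complex.I).im = 1 := by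
      rw [Complex.add_im, Complex.div_natCast_im]
      simp
    simp [this]
  have hphase (t : Exponent) (x y w : ℝ) :
      phase N t (x + Complex.I, (y : ℂ), w / N + Complex.I) =
        phase N t (((0 : ℝ) : ℂ) + Complex.I, ((0 : ℝ) : ℂ), ((0 : ℝ) : ℂ) / N + Complex.I) +
          (((t.2.1 : ℤ) : ℂ) * x + (t.2.2 : ℂ) * y + ((t.1 : ℤ) : ℂ) * w) := by
    rw [phase_apply, phase_apply]
    push_cast
    field_simp
    ring
  have h := norm_coeff_le (hs _ (hmem 0 0 0)) (fun t => t.2.1) (fun t => t.2.2) (fun t => t.1)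
    (fun i j h1 h2 h3 => by
      ext
      · exact_mod_cast h3
      · exact_mod_cast h1
      · rw [h2]) (B := 0) (fun x _ y _ w _ => ?_) t
  · have h1 := norm_le_zero_iff.1 h
    refine (mul_eq_zero.1 h1).resolve_right ?_
    exact Complex.exp_ne_zero _
  · have := h0 _ (hmem x y w)
    simp only [hphase _ x y w, e_add (phase _ _ _), ← mul_assoc] at this
    rw [this, norm_zero]

/-! ### From a paramodular form to the two conditions. -/

theorem involutionCondition_of_expansion {k : ℤ} {N : ℕ} (hN : 0 < N) {ε : ℤ}
    {φ : ℕ → ℂ × ℂ → ℂ} (hε : ε * ε = 1) (hφ : IsFormalJacobiSeries k N φ)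
    (hg : GrowthCondition N φ) {f : Matrix (Fin 2) (Fin 2) ℂ → ℂ}
    (hμ : ∀ Ω ∈ siegelH2, slash k f (mu N) Ω = ε * f Ω)
    (hf : IsFourierJacobiExpansion N f φ) : InvolutionCondition N ε φ := by
  have hsum (p) (hp : symMat p ∈ siegelH2) : f (symMat p) = ∑' t, fourierTerm N φ t p :=
    ((isFourierJacobiExpansion_iff hN).1 hf p hp).unique (hasSum_fourierJacobi hN hφ hg hp)
  rw [involutionCondition_iff hN]
  intro t
  have hs1 {p} (hp : symMat p ∈ siegelH2) := (summable_coeff_swap hN hg hp).of_norm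
  have hs2 {p} (hp : symMat p ∈ siegelH2) : Summable fun t => ε * (coeff N φ t * e (phase N t p)) :=
    (summable_norm_fourierTerm hN hg hp).of_norm.mul_left (ε : ℂ)
  have hd (p t) : (coeff N φ (swapExponent t) - ε * coeff N φ t) * e (phase N t p) =
      coeff N φ (swapExponent t) * e (phase N t p) - ε * (coeff N φ t * e (phase N t p)) := by ring
  have h := coeff_eq_zero_of_tsum_eq_zero hN
    (d := fun t => coeff N φ (swapExponent t) - ε * coeff N φ t) (fun p hp => ?_) (fun p hp => ?_) t
  · rw [sub_eq_zero.1 h, ← mul_assoc]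
    have : (ε : ℂ) * ε = 1 := by exact_mod_cast hε
    rw [this, one_mul]
  · simp only [hd]
    exact ((hs1 hp).sub (hs2 hp)).norm
  · simp only [hd]
    rw [(hs1 hp).tsum_sub (hs2 hp), tsum_mul_left, ← tsum_fourierTerm_muAct hN,
      ← hsum _ (muAct_mem hN hp), ← slash_mu hN k f, hμ _ hp, hsum p hp]
    exact sub_self _

/-- The Fourier-Jacobi expansion does not yet give absolute convergence in all three variables. The
estimate is therefore made in two stages, in `ω` to bound `φ_m` and then in `(τ, z)` to bound its
coefficients; each stage is a series known to converge absolutely. -/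
theorem growthCondition_of_expansion {k : ℤ} {N : ℕ} (hN : 0 < N)
    {φ : ℕ → ℂ × ℂ → ℂ} (hφ : IsFormalJacobiSeries k N φ)
    {f : Matrix (Fin 2) (Fin 2) ℂ → ℂ} (hf : HolomorphicOnH2 f)
    (hexp : IsFourierJacobiExpansion N f φ) : GrowthCondition N φ := by
  intro ρ hρ
  have hπ := Real.pi_pos
  have hlog := Real.log_pos hρ
  set δ := Real.log ρ / (2 * Real.pi) with hδ
  have hδ0 : 0 < δ := by positivity
  have hρδ (m : ℕ) : Real.exp (2 * Real.pi * (m * δ)) = ρ ^ m := by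
    rw [← Real.exp_log (zero_lt_one.trans hρ), ← Real.exp_nat_mul]
    congr 1
    rw [hδ]
    field_simp
  set P : ℝ × ℝ × ℝ → ℂ × ℂ × ℂ := fun x =>
    (x.1 + δ * Complex.I, (x.2.1 : ℂ), x.2.2 + δ * Complex.I) with hP
  have hPmem (x) : symMat (P x) ∈ siegelH2 := by
    rw [symMat_mem_iff]
    simp [hP, hδ0]
  have hcont : Continuous fun x => f (symMat (P x)) := by
    have hc := hf.continuousOn
    exact hc.comp_continuous (by fun_prop) hPmem
  obtain ⟨B, hB⟩ := ((isCompact_Icc (a := (0 : ℝ)) (b := 1)).prod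
    ((isCompact_Icc (a := (0 : ℝ)) (b := 1)).prod
      (isCompact_Icc (a := (0 : ℝ)) (b := 1)))).exists_bound_of_continuousOn hcont.continuousOn
  have hB' : ∀ x ∈ Set.Icc (0 : ℝ) 1, ∀ y ∈ Set.Icc (0 : ℝ) 1, ∀ w ∈ Set.Icc (0 : ℝ) 1,
      ‖f (symMat (P (x, y, w)))‖ ≤ B := fun x hx y hy w hw => hB (x, y, w) ⟨hx, hy, hw⟩
  have hB0 : 0 ≤ B := (norm_nonneg _).trans (hB' 0 (by simp) 0 (by simp) 0 (by simp))
  have hFJ := (isFourierJacobiExpansion_iff hN).1 hexp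
  have hjac (l : ℕ) : ∀ x ∈ Set.Icc (0 : ℝ) 1, ∀ y ∈ Set.Icc (0 : ℝ) 1,
      ‖φ (l * N) (x + δ * Complex.I, (y : ℂ))‖ ≤ B * ρ ^ (l * N) := by
    intro x hx y hy
    have hphase (l : ℕ) (w : ℝ) : e ((l * N : ℕ) * (P (x, y, w)).2.2) =
        e ((l * N : ℕ) * (P (x, y, 0)).2.2) *
          e (((l * N : ℕ) : ℤ) * (w : ℂ) + ((0 : ℤ) : ℂ) * ((0 : ℝ) : ℂ) +
            ((0 : ℤ) : ℂ) * ((0 : ℝ) : ℂ)) := by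
      rw [← e_add]
      congr 1
      simp only [hP]
      push_cast
      ring
    have h := norm_coeff_le (hFJ _ (hPmem (x, y, 0))).summable.norm (fun l => ((l * N : ℕ) : ℤ))
      (fun _ => 0) (fun _ => 0) (fun i j h1 _ _ => Nat.eq_of_mul_eq_mul_right hN (by exact_mod_cast h1))
      (B := B) (fun w hw _ _ _ _ => ?_) l
    · rw [norm_mul, norm_e] at h
      have him : (((l * N : ℕ) : ℂ) * (P (x, y, 0)).2.2).im = (l * N : ℕ) * δ := by
        rw [natCast_mul_im]
        simp [hP]
      rw [him, Real.exp_neg, hρδ, ← div_eq_mul_inv, div_le_iff₀ (by positivity)] at h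
      exact h
    · have h1 := (hFJ _ (hPmem (x, y, w))).tsum_eq
      have h2 := hB' x hx y hy w hw
      rw [← h1] at h2
      convert h2 using 2
      refine tsum_congr fun l => ?_
      rw [hphase l w, ← mul_assoc]
      simp [hP]
  -- The bound `B` may vanish, while the constant must be positive.
  refine ⟨B + 1, by linarith, fun n r m hm => ?_⟩
  obtain ⟨ht, l, rfl⟩ := isSemiIndex_iff.1 hm
  rw [mul_comm N l] at ht ⊢
  have hfour (x y : ℝ) := (hφ (l * N) (dvd_mul_left _ _)).fourier (x + δ * Complex.I) y
    (by simpa using hδ0)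
  have hphase (q : ℕ × ℤ) (x y : ℝ) : e (q.1 * (x + δ * Complex.I) + q.2 * y) =
      e (q.1 * (((0 : ℝ) : ℂ) + δ * Complex.I) + q.2 * ((0 : ℝ) : ℂ)) *
        e (((q.1 : ℤ) : ℂ) * x + (q.2 : ℂ) * y + ((0 : ℤ) : ℂ) * ((0 : ℝ) : ℂ)) := by
    rw [← e_add]
    congr 1
    push_cast
    ring
  have h := norm_coeff_le (hfour 0 0).summable.norm (fun q => (q.1.1 : ℤ)) (fun q => q.1.2)
    (fun _ => 0) (fun i j h1 h2 _ => Subtype.ext (Prod.ext (by exact_mod_cast h1) h2))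
    (B := B * ρ ^ (l * N)) (fun x hx y hy _ _ => ?_) ⟨(n, r), ht⟩
  · rw [norm_mul, norm_e] at h
    have him : ((n : ℂ) * (((0 : ℝ) : ℂ) + δ * Complex.I) + r * ((0 : ℝ) : ℂ)).im = n * δ := by
      simp
    rw [him, Real.exp_neg, hρδ, ← div_eq_mul_inv, div_le_iff₀ (by positivity)] at h
    calc _ ≤ _ := h
      _ = B * ρ ^ (n + l * N) := by rw [pow_add]; ring
      _ ≤ _ := by gcongr; linarith
  · have h1 := (hfour x y).tsum_eq
    have h2 := hjac l x hx y hy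
    rw [← h1] at h2
    convert h2 using 2
    refine tsum_congr fun q => ?_
    rw [hphase q.1 x y, ← mul_assoc]
    simp

/-! ### From the two conditions to a paramodular form. -/

/-- The function on the half space defined by the formal series. -/
def seriesSum (N : ℕ) (φ : ℕ → ℂ × ℂ → ℂ) (Ω : Matrix (Fin 2) (Fin 2) ℂ) : ℂ :=
  ∑' t, fourierTerm N φ t (Ω 0 0, Ω 0 1, Ω 1 1)

theorem seriesSum_symMat (N : ℕ) (φ : ℕ → ℂ × ℂ → ℂ) (p : ℂ × ℂ × ℂ) :
    seriesSum N φ (symMat p) = ∑' t, fourierTerm N φ t p := by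
  simp [seriesSum, symMat]

theorem isFourierJacobiExpansion_seriesSum {k : ℤ} {N : ℕ} (hN : 0 < N) {φ : ℕ → ℂ × ℂ → ℂ}
    (hφ : IsFormalJacobiSeries k N φ) (hg : GrowthCondition N φ) :
    IsFourierJacobiExpansion N (seriesSum N φ) φ := by
  rw [isFourierJacobiExpansion_iff hN]
  intro p hp
  rw [seriesSum_symMat]
  exact hasSum_fourierJacobi hN hφ hg hp

theorem slash_mu_seriesSum {N : ℕ} (hN : 0 < N) {ε : ℤ} (hε : ε * ε = 1) (k : ℤ)
    {φ : ℕ → ℂ × ℂ → ℂ} (hi : InvolutionCondition N ε φ) :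
    ∀ Ω ∈ siegelH2, slash k (seriesSum N φ) (mu N) Ω = ε * seriesSum N φ Ω := by
  intro Ω hΩ
  rw [eq_symMat hΩ.1, slash_mu hN, seriesSum_symMat, seriesSum_symMat, tsum_fourierTerm_muAct hN,
    ← tsum_mul_left]
  refine tsum_congr fun t => ?_
  have : (ε : ℂ) * ε = 1 := by exact_mod_cast hε
  rw [fourierTerm, (involutionCondition_iff hN).1 hi t, ← mul_assoc, ← mul_assoc, this, one_mul]

/-- The Jacobi group fixes every Fourier-Jacobi term separately, so the expansion at the image
point, times the automorphy factor, is the original expansion. -/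
theorem slash_jacobi_of_expansion {k : ℤ} {N : ℕ} {φ : ℕ → ℂ × ℂ → ℂ}
    (hφ : IsFormalJacobiSeries k N φ) {f : Matrix (Fin 2) (Fin 2) ℂ → ℂ}
    (hf : IsFourierJacobiExpansion N f φ) {γ : Matrix Idx Idx ℤ} (h : γ ∈ jacobiGroup) :
    jacobiSp γ h ∈ stabilizer k f := by
  rw [mem_stabilizer]
  intro Ω hΩ
  have h1 := hf _ (moebius_mem (jacobiSp γ h).2 hΩ)
  have h2 := h1.mul_left ((denom (jacobiSp γ h).1 Ω).det ^ (-k))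
  refine (h2.congr_fun fun m => ?_).unique (hf Ω hΩ)
  exact ((hφ m.1 m.2).slash_eq γ h Ω hΩ).symm

/-- The exponent changes by `lN · s/N = ls`, an integer. -/
theorem slash_transl_seriesSum {N : ℕ} (hN : 0 < N) (k s : ℤ) (φ : ℕ → ℂ × ℂ → ℂ) :
    transl (s / N) ∈ stabilizer k (seriesSum N φ) := by
  have hN0 : (N : ℂ) ≠ 0 := by exact_mod_cast hN.ne'
  rw [mem_stabilizer]
  intro Ω hΩ
  have hd : denom (transl (s / N)).1 Ω = 1 := by
    simp [denom, transl]
  have hn : numer (transl (s / N)).1 Ω = Ω + !![0, 0; 0, (s : ℂ) / N] := by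
    simp [numer, transl, map_fin_two]
  rw [slash_apply, moebius, hd, hn, det_one, _root_.one_zpow, one_mul, inv_one, Matrix.mul_one, seriesSum,
    seriesSum]
  refine tsum_congr fun t => ?_
  rw [fourierTerm, fourierTerm]
  have : phase N t ((Ω + !![0, 0; 0, (s : ℂ) / N]) 0 0, (Ω + !![0, 0; 0, (s : ℂ) / N]) 0 1,
      (Ω + !![0, 0; 0, (s : ℂ) / N]) 1 1) = phase N t (Ω 0 0, Ω 0 1, Ω 1 1) + ((t.1 * s : ℤ) : ℂ) := by
    rw [phase_apply, phase_apply]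
    simp
    field_simp
    ring
  rw [this, e_add, e_int, mul_one]

theorem isParamodularEigenform_seriesSum {k : ℤ} {N : ℕ} (hN : 0 < N) (ε : ℤˣ)
    {φ : ℕ → ℂ × ℂ → ℂ} (hφ : IsFormalJacobiSeries k N φ) (hi : InvolutionCondition N ε φ)
    (hg : GrowthCondition N φ) : IsParamodularEigenform k N ε (seriesSum N φ) := by
  have hmu := slash_mu_seriesSum hN (coe_units_int_mul_self ε) k hi
  refine ⟨⟨?_, fun σ hσ Ω hΩ => ?_⟩, hmu⟩
  · rw [HolomorphicOnH2]
    simp only [seriesSum_symMat]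
    exact differentiableOn_tsum_fourierTerm hN hg
  · have hmem : (⟨σ.map (fun x : ℚ => (x : ℝ)),
        SymplecticGroup.map_mem hσ.1 (Rat.castHom ℝ)⟩ : symplecticGroup (Fin 2) ℝ) ∈
          stabilizer k (seriesSum N φ) :=
      mem_of_mem_paramodularGroup hN
        (fun γ h => slash_jacobi_of_expansion hφ (isFourierJacobiExpansion_seriesSum hN hφ hg) h)
        (fun τ hτ => conj_mem_stabilizer (μ := muSp hN) (ε := ε) hmu hτ)
        (fun s => slash_transl_seriesSum hN k s φ) hσ rfl
    exact mem_stabilizer.1 hmem Ω hΩ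

end Paramodular
end
theorem theorem2p2 (k : ℤ) (hk : 0 ≤ k) (N : ℕ) (hN : 0 < N) (ε : ℤ) (hε : ε = 1 ∨ ε = -1)
    (φ : ℕ → ℂ × ℂ → ℂ) (hφ : Paramodular.IsFormalJacobiSeries k N φ) :
    (∃ f : Matrix (Fin 2) (Fin 2) ℂ → ℂ,
      Paramodular.IsParamodularEigenform k N ε f ∧
        Paramodular.IsFourierJacobiExpansion N f φ) ↔
      (Paramodular.InvolutionCondition N ε φ ∧ Paramodular.GrowthCondition N φ) := by
  -- As a unit, the sign can be paired with `μ_N` inside the group containing `signStabilizer`.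
  obtain ⟨ε, rfl⟩ : ∃ u : ℤˣ, (u : ℤ) = ε := by
    rcases hε with rfl | rfl
    · exact ⟨1, rfl⟩
    · exact ⟨-1, rfl⟩
  constructor
  · rintro ⟨f, hf, hexp⟩
    have hg := Paramodular.growthCondition_of_expansion hN hφ hf.holo hexp
    exact ⟨Paramodular.involutionCondition_of_expansion hN
      (Paramodular.coe_units_int_mul_self ε) hφ hg hf.slash_mu hexp, hg⟩
  · rintro ⟨hi, hg⟩
    exact ⟨Paramodular.seriesSum N φ,
      Paramodular.isParamodularEigenform_seriesSum hN ε hφ hi hg,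
      Paramodular.isFourierJacobiExpansion_seriesSum hN hφ hg⟩
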